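/- Let $A$ be a (not necessarily unital) complex C$^*$-algebra with multiplier algebra $M(A)$. The strict topology on $M(A)$ is the one generated by the maps $x\mapsto xb$ and $x\mapsto bx$, $b\in A$, into $A$ with its norm. A strongly continuous one-parameter representation on $A$ is a map $\alpha:\mathbb R\to\mathcal B(A)$ with $\alpha_{s+t}=\alpha_s\alpha_t$, $\alpha_0=\iota$, $\|\alpha_t\|\le 1$ for all $s,t\in\mathbb R$, and $t\mapsto\alpha_t(a)$ norm continuous for all $a\in A$. It is called semi-multiplicative if there are strongly continuous one-parameter representations $\alpha^l,\alpha^r$ on $A$ with $\alpha^l_t(b)\,\alpha_t(a)=\alpha_t(ba)$ and $\alpha_t(a)\,\alpha^r_t(b)=\alpha_t(ab)$ for all $a,b\in A$, $t\in\mathbb R$. In that case each $\alpha_t$ has a unique linear extension $\overline{\alpha_t}:M(A)\to M(A)$ that is strictly continuous on bounded sets. For $z\in\mathbb C$ let $S(z)=\{y\in\mathbb C: \operatorname{Im} y \text{ lies between } 0 \text{ and } \operatorname{Im} z\}$ (endpoints included), with interior $S(z)^0$. The operator $\alpha_z$ in $A$ has as domain $D(\alpha_z)$ the set of all $a\in A$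 for which there is $f:S(z)\to A$ that is norm continuous on $S(z)$, analytic on $S(z)^0$ and satisfies $f(t)=\alpha_t(a)$ for all $t\in\mathbb R$; then $\alpha_z(a)=f(z)$. The operator $\overline{\alpha}_z$ in $M(A)$ has as domain the set of all $a\in M(A)$ for which there is $f:S(z)\to M(A)$ that is strictly continuous on $S(z)$, norm analytic on $S(z)^0$ and satisfies $f(t)=\overline{\alpha_t}(a)$ for all $t\in\mathbb R$; then $\overline{\alpha}_z(a)=f(z)$. Products of partially defined operators are taken on their natural domains, e.g. $D(\alpha_z\beta_z)=\{a\in D(\beta_z):\beta_z(a)\in D(\alpha_z)\}$. A strict core for an operator $T$ in $M(A)$ is a subspace $D\subseteq D(T)$ such that the graph of $T$ is the closure of the graph of $T|_D$ in the product of the strict topologies. Let $\alpha$ and $\beta$ be semi-multiplicative strongly continuous one-parameter representations on $A$ that commute, i.e. $\alpha_s\beta_t=\beta_t\alpha_s$ for all $s,t\in\mathbb R$, and put $\gamma_t=\alpha_t\beta_t$ for $t\in\mathbb R$ (this is again a semi-multiplicative strongly continuous one-parameter representation). Then for every $z\in\mathbb C$: $$\overline{\alpha}_z\,\overline{\beta}_z\subseteq\overline{\gamma}_z,\qquad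 \overline{\beta}_z\,\overline{\alpha}_z\subseteq\overline{\gamma}_z,$$ and $D(\alpha_z\beta_z)\cap D(\beta_z\alpha_z)$, viewed as a subspace of $M(A)$, is a strict core for $\overline{\gamma}_z$. -/

import Mathlib

open scoped MultiplierAlgebra

noncomputable section

namespace OneParam

/-! ### Partially defined operators -/

/-- The product `g f` of two partially defined operators, on its natural domain
`{x ∈ D(f) | f x ∈ D(g)}`. -/
def pcomp {E : Type*} [AddCommGroup E] [Module ℂ E] (g f : E →ₗ.[ℂ] E) : E →ₗ.[ℂ] E :=
  g.comp (f.domRestrict ((g.domain.comap f.toFun).map f.domain.subtype)) (by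
    rintro ⟨x, ⟨⟨y, hy⟩, hgy, rfl⟩, hx⟩
    exact hgy)

theorem mem_pcomp_graph {E : Type*} [AddCommGroup E] [Module ℂ E] {g f : E →ₗ.[ℂ] E} {x y : E} :
    (x, y) ∈ (pcomp g f).graph ↔ ∃ w, (x, w) ∈ f.graph ∧ (w, y) ∈ g.graph := by
  simp only [LinearPMap.mem_graph_iff]
  constructor
  · rintro ⟨⟨x', ⟨⟨y', hy'⟩, hgy, rfl⟩, hx⟩, rfl, rfl⟩
    exact ⟨f ⟨y', hy'⟩, ⟨⟨y', hy'⟩, rfl, rfl⟩, ⟨⟨f ⟨y', hy'⟩, hgy⟩, rfl, rfl⟩⟩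
  · rintro ⟨w, ⟨⟨x', hx'⟩, rfl, rfl⟩, ⟨⟨w', hw'⟩, h1, rfl⟩⟩
    have hw : w' = f ⟨x', hx'⟩ := h1
    subst hw
    exact ⟨⟨x', ⟨⟨x', hx'⟩, hw', rfl⟩, hx'⟩, rfl, rfl⟩

/-! ### One-parameter representations on a Banach space -/

/-- Strongly continuous one-parameter representations by contractions. -/
structure IsRep {E : Type*} [NormedAddCommGroup E] [NormedSpace ℂ E]
    (α : ℝ → E →L[ℂ] E) : Prop where
  add : ∀ s t : ℝ, α (s + t) = α s ∘L α t
  zero : α 0 = ContinuousLinearMap.id ℂ E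
  norm_le : ∀ t : ℝ, ‖α t‖ ≤ 1
  continuous : ∀ a : E, Continuous fun t : ℝ => α t a

/-- The closed horizontal strip between the real axis and the line through `z`. -/
def strip (z : ℂ) : Set ℂ := {y : ℂ | y.im ∈ Set.uIcc 0 z.im}

/-- The graph of the norm analytic continuation `α_z`: all `(a, f z)` where `f` is norm continuous
on the strip, analytic in its interior, and equal to `t ↦ α_t(a)` on the real axis. -/
def contGraph {E : Type*} [NormedAddCommGroup E] [NormedSpace ℂ E]
    (α : ℝ → E →L[ℂ] E) (z : ℂ) : Submodule ℂ (E × E) where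
  carrier := {p | ∃ f : ℂ → E, ContinuousOn f (strip z) ∧
    AnalyticOnNhd ℂ f (interior (strip z)) ∧ (∀ t : ℝ, f t = α t p.1) ∧ f z = p.2}
  add_mem' := by
    rintro p q ⟨f, hf, hf', hfα, hfz⟩ ⟨g, hg, hg', hgα, hgz⟩
    exact ⟨f + g, hf.add hg, hf'.add hg', fun t => by simp [hfα, hgα], by simp [hfz, hgz]⟩
  zero_mem' := ⟨fun _ => 0, continuousOn_const, analyticOnNhd_const, by simp, rfl⟩
  smul_mem' := by
    rintro c p ⟨f, hf, hf', hfα, hfz⟩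
    exact ⟨fun u => c • f u, hf.const_smul c, analyticOnNhd_const.smul hf',
      fun t => by simp [hfα], by simp [hfz]⟩

/-- The norm analytic continuation `α_z`, a partially defined operator in `E`
(see `cont_graph` for its graph). -/
def cont {E : Type*} [NormedAddCommGroup E] [NormedSpace ℂ E]
    (α : ℝ → E →L[ℂ] E) (z : ℂ) : E →ₗ.[ℂ] E :=
  (contGraph α z).toLinearPMap

/-! ### The strict topology on the multiplier algebra -/

/-- The strict topology on `M(A)`: the coarsest one for which all maps `x ↦ x b` and `x ↦ b x`
from `M(A)` to `A`, with `b ∈ A`, are norm continuous. For a double centralizer `x`, `x.fst b`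
is `x b` and `x.snd b` is `b x`. -/
@[reducible]
def strictTopology (A : Type*) [NonUnitalCStarAlgebra A] : TopologicalSpace 𝓜(ℂ, A) :=
  TopologicalSpace.induced
    (fun x => ((fun b => x.fst b, fun b => x.snd b) : (A → A) × (A → A))) inferInstance

/-- Strict continuity on a set of a function with values in `M(A)`. -/
def StrictContinuousOn {A : Type*} [NonUnitalCStarAlgebra A] {X : Type*} [TopologicalSpace X]
    (f : X → 𝓜(ℂ, A)) (s : Set X) : Prop :=
  @ContinuousOn X 𝓜(ℂ, A) _ (strictTopology A) f s

theorem strictContinuousOn_iff {A : Type*} [NonUnitalCStarAlgebra A] {X : Type*}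
    [TopologicalSpace X] {f : X → 𝓜(ℂ, A)} {s : Set X} :
    StrictContinuousOn f s ↔
      ∀ b : A, ContinuousOn (fun u => (f u).fst b) s ∧ ContinuousOn (fun u => (f u).snd b) s := by
  let _ := strictTopology A
  have hind : Topology.IsInducing (fun x : 𝓜(ℂ, A) =>
      ((fun b => x.fst b, fun b => x.snd b) : (A → A) × (A → A))) := ⟨rfl⟩
  refine Iff.trans (hind.continuousOn_iff (f := f) (s := s)) ?_
  constructor
  · intro h b
    exact ⟨(continuous_apply b).comp_continuousOn (continuous_fst.comp_continuousOn h),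
      (continuous_apply b).comp_continuousOn (continuous_snd.comp_continuousOn h)⟩
  · intro h
    exact (continuousOn_pi.2 fun b => (h b).1).prodMk (continuousOn_pi.2 fun b => (h b).2)

/-- The inclusion of `A` in `M(A)`. -/
def incl (A : Type*) [NonUnitalCStarAlgebra A] : A →ₗ[ℂ] 𝓜(ℂ, A) where
  toFun a := (a : 𝓜(ℂ, A))
  map_add' a b := map_add (DoubleCentralizer.coeHom (𝕜 := ℂ) (A := A)) a b
  map_smul' c a := map_smul (DoubleCentralizer.coeHom (𝕜 := ℂ) (A := A)) c a

/-- `θ` is a linear extension of `ρ` to `M(A)` that is strictly continuous on bounded sets. -/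
structure IsStrictExtension {A : Type*} [NonUnitalCStarAlgebra A] (ρ : A →L[ℂ] A)
    (θ : 𝓜(ℂ, A) →ₗ[ℂ] 𝓜(ℂ, A)) : Prop where
  extends_apply : ∀ a : A, θ (a : 𝓜(ℂ, A)) = (ρ a : 𝓜(ℂ, A))
  continuousOn : ∀ s : Set 𝓜(ℂ, A), Bornology.IsBounded s →
    @ContinuousOn 𝓜(ℂ, A) 𝓜(ℂ, A) (strictTopology A) (strictTopology A) θ s

/-- The strict extension of `ρ` to `M(A)`. It exists and is unique for the operators considered
below (see `existsUnique_strictExtension` and its corollaries). -/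
def strictExtension {A : Type*} [NonUnitalCStarAlgebra A] (ρ : A →L[ℂ] A) :
    𝓜(ℂ, A) →ₗ[ℂ] 𝓜(ℂ, A) :=
  Classical.epsilon (IsStrictExtension ρ)

/-! ### Semi-multiplicative representations and their strict continuations -/

/-- `α` is semi-multiplicative: there are strongly continuous one-parameter representations `αl`,
`αr` with `αl_t(b) α_t(a) = α_t(b a)` and `α_t(a) αr_t(b) = α_t(a b)`. -/
def IsSemiMultiplicative {A : Type*} [NonUnitalCStarAlgebra A] (α : ℝ → A →L[ℂ] A) : Prop :=
  ∃ αl αr : ℝ → A →L[ℂ] A, IsRep αl ∧ IsRep αr ∧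
    ∀ (t : ℝ) (a b : A), αl t b * α t a = α t (b * a) ∧ α t a * αr t b = α t (a * b)

/-- The graph of the strict analytic continuation of `α`: all `(a, f z)` where `f` is strictly
continuous on the strip, norm analytic in its interior, and equal to `t ↦ α_t(a)` on the real axis,
`α_t` being extended to `M(A)`. -/
def strictContGraph {A : Type*} [NonUnitalCStarAlgebra A] (α : ℝ → A →L[ℂ] A) (z : ℂ) :
    Submodule ℂ (𝓜(ℂ, A) × 𝓜(ℂ, A)) where
  carrier := {p | ∃ f : ℂ → 𝓜(ℂ, A), StrictContinuousOn f (strip z) ∧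
    AnalyticOnNhd ℂ f (interior (strip z)) ∧
    (∀ t : ℝ, f t = strictExtension (α t) p.1) ∧ f z = p.2}
  add_mem' := by
    rintro p q ⟨f, hf, hf', hfα, hfz⟩ ⟨g, hg, hg', hgα, hgz⟩
    rw [strictContinuousOn_iff] at hf hg
    refine ⟨f + g, strictContinuousOn_iff.2 fun b => ⟨?_, ?_⟩, hf'.add hg',
      fun t => by simp [hfα, hgα], by simp [hfz, hgz]⟩
    · exact (hf b).1.add (hg b).1
    · exact (hf b).2.add (hg b).2
  zero_mem' := ⟨fun _ => 0, strictContinuousOn_iff.2 fun b =>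
    ⟨continuousOn_const, continuousOn_const⟩, analyticOnNhd_const, by simp, rfl⟩
  smul_mem' := by
    rintro c p ⟨f, hf, hf', hfα, hfz⟩
    rw [strictContinuousOn_iff] at hf
    refine ⟨fun u => c • f u, strictContinuousOn_iff.2 fun b => ⟨?_, ?_⟩,
      analyticOnNhd_const.smul hf', fun t => by simp [hfα], by simp [hfz]⟩
    · exact (hf b).1.const_smul c
    · exact (hf b).2.const_smul c

/-- The strict analytic continuation of `α` at `z`, a partially defined operator in `M(A)`
(see `strictCont_graph` for its graph). -/
def strictCont {A : Type*} [NonUnitalCStarAlgebra A] (α : ℝ → A →L[ℂ] A) (z : ℂ) :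
    𝓜(ℂ, A) →ₗ.[ℂ] 𝓜(ℂ, A) :=
  (strictContGraph α z).toLinearPMap

/-- `S` is a strict core for `T`: it is contained in the domain, and the graph of `T` is the strict
closure of the graph of the restriction of `T` to `S`. -/
def IsStrictCore {A : Type*} [NonUnitalCStarAlgebra A] (T : 𝓜(ℂ, A) →ₗ.[ℂ] 𝓜(ℂ, A))
    (S : Submodule ℂ 𝓜(ℂ, A)) : Prop :=
  S ≤ T.domain ∧
    @closure (𝓜(ℂ, A) × 𝓜(ℂ, A))
      (@instTopologicalSpaceProd _ _ (strictTopology A) (strictTopology A))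
      ((T.domRestrict S).graph : Set (𝓜(ℂ, A) × 𝓜(ℂ, A))) = T.graph

/-! ### The continuations are well defined -/

theorem strip_eq_of_pos {z : ℂ} (hz : 0 < z.im) : strip z = Complex.im ⁻¹' Set.Icc 0 z.im := by
  ext y
  simp [strip, Set.uIcc_of_le hz.le]

theorem interior_strip_of_pos {z : ℂ} (hz : 0 < z.im) :
    interior (strip z) = Complex.im ⁻¹' Set.Ioo 0 z.im := by
  rw [strip_eq_of_pos hz, ← Complex.isOpenMap_im.preimage_interior_eq_interior_preimage
    Complex.continuous_im, interior_Icc]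

/-- A scalar function that vanishes on the real axis vanishes at the centre of every square in the
strip that has a side on that axis. -/
theorem eq_zero_of_square {g : ℂ → ℂ} {z c : ℂ} (hz : 0 < z.im)
    (hg : ContinuousOn g (strip z)) (hg' : AnalyticOnNhd ℂ g (interior (strip z)))
    (h0 : ∀ t : ℝ, g t = 0) (hc : 0 < c.im) (hc' : 2 * c.im < z.im) : g c = 0 := by
  rw [interior_strip_of_pos hz] at hg'
  rw [strip_eq_of_pos hz] at hg
  set r := c.im with hr
  set U : Set ℂ := Set.Ioo (-r) r ×ℂ Set.Ioo (-r) r with hU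
  have hne : (-r) ≠ r := by linarith
  have hcl : closure U = Set.Icc (-r) r ×ℂ Set.Icc (-r) r := by
    rw [hU, Complex.closure_reProdIm, closure_Ioo hne]
  have key : ∀ m : ℂ, (m = 1 ∨ m = -1 ∨ m = Complex.I ∨ m = -Complex.I) →
      DiffContOnCl ℂ (fun ζ => g (c + m * ζ)) U := by
    intro m hm
    constructor
    · refine hg'.differentiableOn.comp (by fun_prop) ?_
      rintro ζ ⟨⟨h1, h2⟩, h3, h4⟩
      rcases hm with rfl | rfl | rfl | rfl <;>
        simp [← hr] <;> constructor <;> linarith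
    · rw [hcl]
      refine hg.comp (by fun_prop) ?_
      rintro ζ ⟨⟨h1, h2⟩, h3, h4⟩
      rcases hm with rfl | rfl | rfl | rfl <;>
        simp [← hr] <;> constructor <;> linarith
  have hzero : ∀ w : ℂ, w.im = 0 → g w = 0 := by
    intro w hw
    have : w = ((w.re : ℝ) : ℂ) := Complex.ext (by simp) (by simp [hw])
    rw [this, h0]
  have hG : DiffContOnCl ℂ (fun ζ => (g (c + 1 * ζ) * g (c + (-1) * ζ)) *
      (g (c + Complex.I * ζ) * g (c + (-Complex.I) * ζ))) U := by
    have h1 := key 1 (by simp)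
    have h2 := key (-1) (by simp)
    have h3 := key Complex.I (by simp)
    have h4 := key (-Complex.I) (by simp)
    exact ⟨(h1.1.mul h2.1).mul (h3.1.mul h4.1), (h1.2.mul h2.2).mul (h3.2.mul h4.2)⟩
  have hb : Bornology.IsBounded U :=
    (Metric.isBounded_Ioo _ _).reProdIm (Metric.isBounded_Ioo _ _)
  have hmax := Complex.norm_le_of_forall_mem_frontier_norm_le hb hG (C := 0) (z := 0)
    (by
      intro ζ hζ
      have hζ' : ζ ∈ closure U := frontier_subset_closure hζ
      rw [hcl] at hζ'
      obtain ⟨⟨h1, h2⟩, h3, h4⟩ := hζ'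
      have hnot : ζ ∉ U := by
        have hop : IsOpen U := isOpen_Ioo.reProdIm isOpen_Ioo
        rw [hop.frontier_eq] at hζ
        exact hζ.2
      have : ζ.re = -r ∨ ζ.re = r ∨ ζ.im = -r ∨ ζ.im = r := by
        by_contra hcon
        push Not at hcon
        obtain ⟨k1, k2, k3, k4⟩ := hcon
        exact hnot ⟨⟨lt_of_le_of_ne h1 k1.symm, lt_of_le_of_ne h2 k2⟩,
          ⟨lt_of_le_of_ne h3 k3.symm, lt_of_le_of_ne h4 k4⟩⟩
      rcases this with h | h | h | h
      · rw [hzero (c + Complex.I * ζ) (by simp [h, ← hr])]; simp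
      · rw [hzero (c + (-Complex.I) * ζ) (by simp [h, ← hr])]; simp
      · rw [hzero (c + 1 * ζ) (by simp [h, ← hr])]; simp
      · rw [hzero (c + (-1) * ζ) (by simp [h, ← hr])]; simp)
    (by rw [hcl]; constructor <;> constructor <;> simp <;> linarith)
  have h4 := norm_le_zero_iff.1 hmax
  simpa using h4

theorem scalar_unique_of_pos {g : ℂ → ℂ} {z : ℂ} (hz : 0 < z.im)
    (hg : ContinuousOn g (strip z)) (hg' : AnalyticOnNhd ℂ g (interior (strip z)))
    (h0 : ∀ t : ℝ, g t = 0) : g z = 0 := by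
  have hsq : ∀ c : ℂ, 0 < c.im → 2 * c.im < z.im → g c = 0 := fun c =>
    eq_zero_of_square hz hg hg' h0
  have hint := interior_strip_of_pos hz
  have hconn : IsPreconnected (interior (strip z)) := by
    rw [hint]
    exact ((convex_Ioo (0 : ℝ) z.im).linear_preimage Complex.imLm).isPreconnected
  set c : ℂ := ⟨0, z.im / 4⟩ with hc
  have hcm : c ∈ interior (strip z) := by
    rw [hint]; constructor <;> simp [hc] <;> linarith
  have hev : g =ᶠ[nhds c] 0 := by
    have hop : IsOpen (Complex.im ⁻¹' Set.Ioo 0 (z.im / 2)) :=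
      isOpen_Ioo.preimage Complex.continuous_im
    filter_upwards [hop.mem_nhds (show c ∈ _ by constructor <;> simp [hc] <;> linarith)]
      with w hw
    exact hsq w hw.1 (by have := hw.2; linarith)
  have hEq : Set.EqOn g 0 (interior (strip z)) :=
    hg'.eqOn_zero_of_preconnected_of_eventuallyEq_zero hconn hcm hev
  have hEq' : Set.EqOn g 0 (strip z) := by
    refine hEq.of_subset_closure hg continuousOn_const interior_subset ?_
    rw [hint, strip_eq_of_pos hz, Complex.closure_preimage_im, closure_Ioo hz.ne]
  exact hEq' (by rw [strip_eq_of_pos hz]; exact ⟨hz.le, le_rfl⟩)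

theorem strip_neg (z : ℂ) : strip (-z) = Neg.neg ⁻¹' strip z := by
  ext y
  simp only [strip, Set.mem_ofPred_eq, Set.mem_preimage, Complex.neg_im, Set.mem_uIcc]
  constructor <;> rintro (h | h)
  · right; constructor <;> linarith
  · left; constructor <;> linarith
  · right; constructor <;> linarith
  · left; constructor <;> linarith

theorem scalar_unique {g : ℂ → ℂ} {z : ℂ}
    (hg : ContinuousOn g (strip z)) (hg' : AnalyticOnNhd ℂ g (interior (strip z)))
    (h0 : ∀ t : ℝ, g t = 0) : g z = 0 := by
  rcases lt_trichotomy z.im 0 with hz | hz | hz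
  · have hs := strip_neg z
    have hi : interior (strip (-z)) = Neg.neg ⁻¹' interior (strip z) := by
      rw [hs]
      exact ((Homeomorph.neg ℂ).preimage_interior (strip z)).symm
    have := scalar_unique_of_pos (g := fun w => g (-w)) (z := -z) (by simpa using hz)
      (hg.comp continuousOn_neg (by rw [hs]; exact fun _ h => h))
      (hg'.comp (analyticOnNhd_id.neg) (by rw [hi]; exact fun _ h => h))
      (fun t => by simpa using h0 (-t))
    simpa using this
  · have : z = ((z.re : ℝ) : ℂ) := Complex.ext (by simp) (by simp [hz])
    rw [this, h0]
  · exact scalar_unique_of_pos hz hg hg' h0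

theorem vector_unique {E : Type*} [NormedAddCommGroup E] [NormedSpace ℂ E] {f : ℂ → E} {z : ℂ}
    (hf : ContinuousOn f (strip z)) (hf' : AnalyticOnNhd ℂ f (interior (strip z)))
    (h0 : ∀ t : ℝ, f t = 0) : f z = 0 := by
  refine SeparatingDual.eq_zero_of_forall_dual_eq_zero (R := ℂ) fun φ => ?_
  exact scalar_unique (g := fun u => φ (f u)) (φ.continuous.comp_continuousOn hf)
    (φ.comp_analyticOnNhd hf') (fun t => by simp [h0])

/-- The function `f` in the definition of `α_z` has a unique value at `z`, so that the graph of
`α_z` is the set it is meant to be. -/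
theorem cont_graph {E : Type*} [NormedAddCommGroup E] [NormedSpace ℂ E]
    (α : ℝ → E →L[ℂ] E) (z : ℂ) : (cont α z).graph = contGraph α z := by
  refine Submodule.toLinearPMap_graph_eq _ ?_
  rintro ⟨a, b⟩ ⟨f, hf, hf', hfα, hfz⟩ (rfl : a = 0)
  rw [← hfz]
  exact vector_unique hf hf' fun t => by simp [hfα]

/-- The same for the strict continuation. -/
theorem strictCont_graph {A : Type*} [NonUnitalCStarAlgebra A] (α : ℝ → A →L[ℂ] A) (z : ℂ) :
    (strictCont α z).graph = strictContGraph α z := by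
  refine Submodule.toLinearPMap_graph_eq _ ?_
  rintro ⟨a, b⟩ ⟨f, hf, hf', hfα, hfz⟩ (rfl : a = 0)
  rw [strictContinuousOn_iff] at hf
  change b = 0
  rw [← show f z = b from hfz]
  have hz : ∀ t : ℝ, f t = 0 := fun t => by simp [hfα]
  let L : A → 𝓜(ℂ, A) →L[ℂ] A := fun c => LinearMap.mkContinuous
    { toFun := fun x => x.fst c, map_add' := fun _ _ => rfl, map_smul' := fun _ _ => rfl } ‖c‖
    (fun x => by
      have := x.fst.le_opNorm c
      rw [DoubleCentralizer.norm_fst, mul_comm] at this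
      exact this)
  let R : A → 𝓜(ℂ, A) →L[ℂ] A := fun c => LinearMap.mkContinuous
    { toFun := fun x => x.snd c, map_add' := fun _ _ => rfl, map_smul' := fun _ _ => rfl } ‖c‖
    (fun x => by
      have := x.snd.le_opNorm c
      rw [DoubleCentralizer.norm_snd, mul_comm] at this
      exact this)
  refine DoubleCentralizer.ext _ _ _ _ (Prod.ext ?_ ?_) <;>
    refine ContinuousLinearMap.ext fun c => ?_
  · exact vector_unique (f := fun u => (f u).fst c) (hf c).1 ((L c).comp_analyticOnNhd hf')
      (fun t => by simp [hz])
  · exact vector_unique (f := fun u => (f u).snd c) (hf c).2 ((R c).comp_analyticOnNhd hf')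
      (fun t => by simp [hz])

/-! ### The strict extensions are well defined -/

theorem eq_of_forall_mul_left {A : Type*} [NonUnitalCStarAlgebra A] {x y : A}
    (h : ∀ c : A, c * x = c * y) : x = y := by
  have h1 : star (x - y) * (x - y) = 0 := by rw [mul_sub, h, sub_self]
  exact sub_eq_zero.1 (CStarRing.star_mul_self_eq_zero_iff _ |>.1 h1)

theorem fst_mul {A : Type*} [NonUnitalCStarAlgebra A] (x : 𝓜(ℂ, A)) (a b : A) :
    x.fst (a * b) = x.fst a * b :=
  eq_of_forall_mul_left fun c => by
    rw [← x.central, ← mul_assoc, x.central, mul_assoc]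

/-- Existence and uniqueness of the strict extension of an operator `ρ` with
`l(b) ρ(a) = ρ(b a)` and `ρ(a) r(b) = ρ(a b)` for surjective `l`, `r`. -/
theorem existsUnique_strictExtension {A : Type*} [NonUnitalCStarAlgebra A]
    (ρ l l' r r' : A →L[ℂ] A) (hl : ∀ a, l (l' a) = a) (hr : ∀ a, r (r' a) = a)
    (hlρ : ∀ a b, l b * ρ a = ρ (b * a)) (hrρ : ∀ a b, ρ a * r b = ρ (a * b)) :
    ∃! θ : 𝓜(ℂ, A) →ₗ[ℂ] 𝓜(ℂ, A), IsStrictExtension ρ θ := by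
  refine existsUnique_of_exists_of_unique ?_ ?_
  · let θ : 𝓜(ℂ, A) →ₗ[ℂ] 𝓜(ℂ, A) :=
      { toFun := fun x =>
          { fst := ρ ∘L x.fst ∘L r'
            snd := ρ ∘L x.snd ∘L l'
            central := fun a b => by
              have h1 := hrρ (x.snd (l' a)) (r' b)
              have h2 := hlρ (x.fst (r' b)) (l' a)
              rw [hr] at h1
              rw [hl, ← x.central] at h2
              exact h1.trans h2.symm }
        map_add' := fun x y => by
          refine DoubleCentralizer.ext _ _ _ _ (Prod.ext ?_ ?_) <;> ext c <;> simp
        map_smul' := fun k x => by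
          refine DoubleCentralizer.ext _ _ _ _ (Prod.ext ?_ ?_) <;> ext c <;> simp }
    refine ⟨θ, ?_, ?_⟩
    · intro a
      refine DoubleCentralizer.ext _ _ _ _ (Prod.ext ?_ ?_) <;>
        refine ContinuousLinearMap.ext fun c => ?_
      · change ρ (a * r' c) = ρ a * c
        rw [← hrρ, hr]
      · change ρ (l' c * a) = c * ρ a
        rw [← hlρ, hl]
    · intro s _
      let _ := strictTopology A
      have hid := strictContinuousOn_iff.1
        (show StrictContinuousOn (fun x : 𝓜(ℂ, A) => x) s from continuousOn_id)
      refine (strictContinuousOn_iff (f := θ)).2 fun b => ⟨?_, ?_⟩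
      · exact ρ.continuous.comp_continuousOn (hid (r' b)).1
      · exact ρ.continuous.comp_continuousOn (hid (l' b)).2
  · intro θ₁ θ₂ h₁ h₂
    let _ := CStarAlgebra.spectralOrder A
    let _ := CStarAlgebra.spectralOrderedRing A
    have hE := CStarAlgebra.increasingApproximateUnit A
    set e := CStarAlgebra.approximateUnit A
    ext1 x
    set s : Set 𝓜(ℂ, A) := Metric.closedBall 0 ‖x‖ with hs
    have hsb : Bornology.IsBounded s := Metric.isBounded_closedBall
    have hmem : ∀ᶠ u in e, ((x.fst u : A) : 𝓜(ℂ, A)) ∈ s := by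
      filter_upwards [hE.eventually_norm] with u hu
      rw [hs, mem_closedBall_zero_iff]
      have hcoe : ‖((x.fst u : A) : 𝓜(ℂ, A))‖ ≤ ‖x.fst u‖ := by
        rw [← DoubleCentralizer.norm_fst, DoubleCentralizer.coe_fst]
        exact ContinuousLinearMap.opNorm_mul_apply_le ℂ A _
      calc _ ≤ ‖x.fst u‖ := hcoe
        _ ≤ ‖x.fst‖ * ‖u‖ := x.fst.le_opNorm u
        _ ≤ ‖x‖ * 1 := by rw [DoubleCentralizer.norm_fst]; gcongr
        _ = ‖x‖ := mul_one _
    have hlim : Filter.Tendsto (fun u => ((x.fst u : A) : 𝓜(ℂ, A))) e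
        (@nhds _ (strictTopology A) x) := by
      rw [strictTopology, nhds_induced, Filter.tendsto_comap_iff]
      refine Filter.Tendsto.prodMk_nhds (tendsto_pi_nhds.2 fun b => ?_)
        (tendsto_pi_nhds.2 fun b => ?_)
      · change Filter.Tendsto (fun u => x.fst u * b) e _
        simp_rw [← fst_mul]
        exact (x.fst.continuous.tendsto b).comp (hE.tendsto_mul_right b)
      · change Filter.Tendsto (fun u => b * x.fst u) e _
        simp_rw [← x.central]
        exact hE.tendsto_mul_left (x.snd b)
    have main : ∀ θ, IsStrictExtension ρ θ → ∀ b : A,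
        Filter.Tendsto (fun u => ((ρ (x.fst u) : A) : 𝓜(ℂ, A)).fst b) e (nhds ((θ x).fst b)) ∧
        Filter.Tendsto (fun u => ((ρ (x.fst u) : A) : 𝓜(ℂ, A)).snd b) e (nhds ((θ x).snd b)) := by
      intro θ h b
      have hc := h.continuousOn s hsb
      let _ := strictTopology A
      have hcb := (strictContinuousOn_iff (f := θ)).1 hc b
      have hw : Filter.Tendsto (fun u => ((x.fst u : A) : 𝓜(ℂ, A))) e (nhdsWithin x s) :=
        tendsto_nhdsWithin_iff.2 ⟨hlim, hmem⟩
      have hx : x ∈ s := mem_closedBall_zero_iff.2 le_rfl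
      refine ⟨?_, ?_⟩
      · refine ((hcb.1 x hx).tendsto.comp hw).congr fun u => ?_
        simp only [Function.comp, h.extends_apply]
      · refine ((hcb.2 x hx).tendsto.comp hw).congr fun u => ?_
        simp only [Function.comp, h.extends_apply]
    have : e.NeBot := hE.neBot
    refine DoubleCentralizer.ext _ _ _ _ (Prod.ext ?_ ?_) <;>
      refine ContinuousLinearMap.ext fun b => ?_
    · exact tendsto_nhds_unique (main θ₁ h₁ b).1 (main θ₂ h₂ b).1
    · exact tendsto_nhds_unique (main θ₁ h₁ b).2 (main θ₂ h₂ b).2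

theorem IsRep.apply_neg {E : Type*} [NormedAddCommGroup E] [NormedSpace ℂ E]
    {α : ℝ → E →L[ℂ] E} (h : IsRep α) (t : ℝ) (a : E) : α t (α (-t) a) = a := by
  have := DFunLike.congr_fun (h.add t (-t)) a
  simpa [h.zero] using this.symm

theorem strictExtension_spec {A : Type*} [NonUnitalCStarAlgebra A] {α : ℝ → A →L[ℂ] A}
    (h : IsSemiMultiplicative α) (t : ℝ) :
    IsStrictExtension (α t) (strictExtension (α t)) ∧
      ∀ θ, IsStrictExtension (α t) θ → θ = strictExtension (α t) := by
  obtain ⟨αl, αr, hl, hr, hα⟩ := h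
  have hex := existsUnique_strictExtension (α t) (αl t) (αl (-t)) (αr t) (αr (-t))
    (hl.apply_neg t) (hr.apply_neg t) (fun a b => (hα t a b).1) (fun a b => (hα t a b).2)
  have hsp : IsStrictExtension (α t) (strictExtension (α t)) := Classical.epsilon_spec hex.exists
  exact ⟨hsp, fun θ hθ => hex.unique hθ hsp⟩

theorem strictExtension_comp_spec {A : Type*} [NonUnitalCStarAlgebra A] {α β : ℝ → A →L[ℂ] A}
    (h : IsSemiMultiplicative α) (h' : IsSemiMultiplicative β) (t : ℝ) :
    IsStrictExtension (α t ∘L β t) (strictExtension (α t ∘L β t)) ∧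
      ∀ θ, IsStrictExtension (α t ∘L β t) θ → θ = strictExtension (α t ∘L β t) := by
  obtain ⟨αl, αr, hl, hr, hα⟩ := h
  obtain ⟨βl, βr, hl', hr', hβ⟩ := h'
  have hex := existsUnique_strictExtension (α t ∘L β t) (αl t ∘L βl t) (βl (-t) ∘L αl (-t))
    (αr t ∘L βr t) (βr (-t) ∘L αr (-t))
    (fun a => by simp [hl'.apply_neg t, hl.apply_neg t])
    (fun a => by simp [hr'.apply_neg t, hr.apply_neg t])
    (fun a b => by simp [(hα t _ _).1, (hβ t _ _).1])
    (fun a b => by simp [(hα t _ _).2, (hβ t _ _).2])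
  have hsp : IsStrictExtension (α t ∘L β t) (strictExtension (α t ∘L β t)) :=
    Classical.epsilon_spec hex.exists
  exact ⟨hsp, fun θ hθ => hex.unique hθ hsp⟩

end OneParam

end

/-! Gaussian smearing makes every orbit entire, and the smearings of a bounded continuous function
converge to it uniformly on a strip as soon as they converge on the two boundary lines. Hence the
graph of `γ_z` consists of the pairs `(a, b)` such that, for every `r > 0`, the smearing with
parameter `r` of the orbit of `a`, evaluated at `z`, equals that of the orbit of `b`, evaluated
at `0`; in particular it is closed.

A pair of multipliers `(a, b)` lies in the graph of the strict continuation of `γ` exactly when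
`x ↦ a x` and `x ↦ x a` map the norm continuations of the companions `γl` and `γr` to norm
continuations of `γ`, with values given by `b`. Strict closedness and the inclusions of the products
thus follow from the norm case. For the core property, multiply a pair of multipliers by a smeared
approximate unit to obtain pairs in the graph of the norm continuation of `γ`, and smear those along
`β` to land in the domains of both products. -/

noncomputable section

namespace OneParam

open Filter Topology MeasureTheory Metric Set

/-! ### Analytic functions on a strip -/

section Strip

theorem ofReal_mem_strip (z : ℂ) (t : ℝ) : (t : ℂ) ∈ strip z := by
  simp [strip]

theorem self_mem_strip (z : ℂ) : z ∈ strip z := by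
  simp [strip]

theorem add_ofReal_mem_strip {z u : ℂ} (hu : u ∈ strip z) (t : ℝ) : u + t ∈ strip z := by
  simpa [strip] using hu

theorem strip_subset_strip {z u : ℂ} (hu : u ∈ strip z) : strip u ⊆ strip z :=
  fun _ hv => uIcc_subset_uIcc left_mem_uIcc hu hv

theorem isClosed_strip (z : ℂ) : IsClosed (strip z) :=
  isClosed_Icc.preimage Complex.continuous_im

theorem interior_strip (z : ℂ) :
    interior (strip z) = Complex.im ⁻¹' Ioo (min 0 z.im) (max 0 z.im) := by
  rw [← interior_Icc, Complex.isOpenMap_im.preimage_interior_eq_interior_preimage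
    Complex.continuous_im]
  rfl

theorem im_sq_le_of_mem_strip {z u : ℂ} (hu : u ∈ strip z) : u.im ^ 2 ≤ z.im ^ 2 := by
  rcases mem_uIcc.1 (show u.im ∈ uIcc 0 z.im from hu) with h | h <;> nlinarith [h.1, h.2]

variable {E F : Type*} [NormedAddCommGroup E] [NormedSpace ℂ E] [NormedAddCommGroup F]
  [NormedSpace ℂ F]

/-- The regularity asked of the functions that define an analytic continuation: continuity on the
closed strip and complex differentiability in its interior. `DiffContOnCl ℂ f (interior (strip z))`
would not do, as it is vacuous for real `z`, where continuity along the real axis is wanted. -/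
structure IsStripAnalytic (f : ℂ → E) (z : ℂ) : Prop where
  continuousOn : ContinuousOn f (strip z)
  differentiableOn : DifferentiableOn ℂ f (interior (strip z))

namespace IsStripAnalytic

variable {f g : ℂ → E} {z : ℂ}

theorem of_differentiable (hf : Differentiable ℂ f) : IsStripAnalytic f z :=
  ⟨hf.continuous.continuousOn, hf.differentiableOn⟩

theorem congr (hf : IsStripAnalytic f z) (h : EqOn g f (strip z)) : IsStripAnalytic g z :=
  ⟨hf.continuousOn.congr h, hf.differentiableOn.congr (h.mono interior_subset)⟩

theorem clm_comp (hf : IsStripAnalytic f z) (L : E →L[ℂ] F) :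
    IsStripAnalytic (fun u => L (f u)) z :=
  ⟨L.continuous.comp_continuousOn hf.continuousOn,
    L.differentiable.comp_differentiableOn hf.differentiableOn⟩

theorem smul {c : ℂ → ℂ} (hc : Differentiable ℂ c) (hf : IsStripAnalytic f z) :
    IsStripAnalytic (fun u => c u • f u) z :=
  ⟨hc.continuous.continuousOn.smul hf.continuousOn,
    hc.differentiableOn.smul hf.differentiableOn⟩

theorem comp_add_ofReal (hf : IsStripAnalytic f z) (t : ℝ) :
    IsStripAnalytic (fun u => f (u + t)) z := by
  refine ⟨hf.continuousOn.comp (by fun_prop) fun _ hu => add_ofReal_mem_strip hu t,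
    hf.differentiableOn.comp (by fun_prop) fun u hu => ?_⟩
  simpa [interior_strip] using hu

theorem continuous_line (hf : IsStripAnalytic f z) {u : ℂ} (hu : u ∈ strip z) :
    Continuous fun t : ℝ => f (u + t) := by
  rw [← continuousOn_univ]
  exact hf.continuousOn.comp (by fun_prop) fun t _ => add_ofReal_mem_strip hu t

theorem continuous_ofReal (hf : IsStripAnalytic f z) : Continuous fun t : ℝ => f t := by
  simpa using hf.continuous_line (ofReal_mem_strip z 0)

theorem mono (hf : IsStripAnalytic f z) {u : ℂ} (hu : u ∈ strip z) : IsStripAnalytic f u :=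
  ⟨hf.continuousOn.mono (strip_subset_strip hu),
    hf.differentiableOn.mono (interior_mono (strip_subset_strip hu))⟩

theorem eqOn [CompleteSpace E] (hf : IsStripAnalytic f z) (hg : IsStripAnalytic g z)
    (h : ∀ t : ℝ, f t = g t) : EqOn f g (strip z) := fun u hu =>
  sub_eq_zero.1 <| vector_unique (f := fun v => f v - g v)
    ((hf.mono hu).continuousOn.sub (hg.mono hu).continuousOn)
    (((hf.mono hu).differentiableOn.sub (hg.mono hu).differentiableOn).analyticOnNhd
      isOpen_interior) fun t => by simp [h]

theorem norm_le_of_boundary (hf : IsStripAnalytic f z) {K C : ℝ}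
    (hK : ∀ u ∈ strip z, ‖f u‖ ≤ K) (h₀ : ∀ x : ℝ, ‖f x‖ ≤ C) (h₁ : ∀ x : ℝ, ‖f (z + x)‖ ≤ C)
    {u : ℂ} (hu : u ∈ strip z) : ‖f u‖ ≤ C := by
  have h_real : ∀ w : ℂ, w.im = 0 → ‖f w‖ ≤ C := fun w hw => by
    rw [show w = (w.re : ℂ) from Complex.ext (by simp) (by simp [hw])]
    exact h₀ _
  have h_top : ∀ w : ℂ, w.im = z.im → ‖f w‖ ≤ C := fun w hw => by
    rw [show w = z + (w.re - z.re : ℝ) from Complex.ext (by simp) (by simp [hw])]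
    exact h₁ _
  by_cases hz : z.im = 0
  · exact h_real u (by simpa [strip, hz] using hu)
  have hlt : min 0 z.im < max 0 z.im := by simpa [min_lt_max] using hz
  have hdiff : DiffContOnCl ℂ f (Complex.im ⁻¹' Ioo (min 0 z.im) (max 0 z.im)) := by
    rw [← interior_strip]
    exact ⟨hf.differentiableOn, hf.continuousOn.mono (closure_minimal interior_subset
      (isClosed_strip z))⟩
  refine PhragmenLindelof.horizontal_strip hdiff
    ⟨0, div_pos Real.pi_pos (sub_pos.2 hlt), 0, Asymptotics.IsBigO.of_bound K ?_⟩
    (fun w hw => ?_) (fun w hw => ?_) hu.1 hu.2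
  · filter_upwards [mem_inf_of_right (mem_principal_self _)] with w hw
    simpa using hK w (Ioo_subset_Icc_self hw)
  · rcases min_choice 0 z.im with h | h <;> rw [h] at hw
    exacts [h_real w hw, h_top w hw]
  · rcases max_choice 0 z.im with h | h <;> rw [h] at hw
    exacts [h_real w hw, h_top w hw]

end IsStripAnalytic

end Strip

/-! ### Gaussian smearing -/

section ParametricIntegral

variable {T E : Type*} [MeasurableSpace T] {μ : Measure T} [NormedAddCommGroup E]
  [NormedSpace ℂ E] {F : ℂ → T → E}

theorem aestronglyMeasurable_deriv_of_eventually {u₀ : ℂ}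
    (hm : ∀ᶠ u in 𝓝 u₀, AEStronglyMeasurable (F u) μ)
    (hd : ∀ t, DifferentiableAt ℂ (fun u => F u t) u₀) :
    AEStronglyMeasurable (fun t => deriv (fun u => F u t) u₀) μ := by
  have hcomap : Tendsto (fun h : ℂ => u₀ + h) (𝓝[≠] 0) (𝓝 u₀) :=
    ((continuous_const_add u₀).tendsto' 0 u₀ (add_zero u₀)).mono_left nhdsWithin_le_nhds
  obtain ⟨h, hh, hmh⟩ := exists_seq_forall_of_frequently (hcomap.eventually hm).frequently
  exact aestronglyMeasurable_of_tendsto_ae atTop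
    (fun n => ((hmh n).sub hm.self_of_nhds).const_smul (h n)⁻¹)
    (Eventually.of_forall fun t => (hasDerivAt_iff_tendsto_slope_zero.1 (hd t).hasDerivAt).comp hh)

theorem differentiableOn_integral_of_dominated {U : Set ℂ} (hU : IsOpen U)
    (hm : ∀ u ∈ U, AEStronglyMeasurable (F u) μ) (hd : ∀ t, DifferentiableOn ℂ (fun u => F u t) U)
    (hb : ∀ u₀ ∈ U, ∃ h : T → ℝ, Integrable h μ ∧ ∀ᶠ u in 𝓝 u₀, ∀ t, ‖F u t‖ ≤ h t) :
    DifferentiableOn ℂ (fun u => ∫ t, F u t ∂μ) U := by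
  intro u₀ hu₀
  obtain ⟨h, hh, hbd⟩ := hb u₀ hu₀
  obtain ⟨R, hR, hball⟩ := Metric.mem_nhds_iff.1 (inter_mem (hU.mem_nhds hu₀) hbd)
  have hsub : ∀ v ∈ ball u₀ (R / 2), closedBall v (R / 2) ⊆ ball u₀ R := fun v hv w hw =>
    mem_ball.2 (by linarith [mem_ball.1 hv, mem_closedBall.1 hw, dist_triangle w v u₀])
  have hdiff : ∀ t, ∀ v ∈ ball u₀ (R / 2), DifferentiableAt ℂ (fun u => F u t) v := fun t v hv =>
    (hd t).differentiableAt (hU.mem_nhds (hball (ball_subset_ball (half_le_self hR.le) hv)).1)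
  have hderiv : ∀ t, ∀ v ∈ ball u₀ (R / 2), ‖deriv (fun u => F u t) v‖ ≤ h t / (R / 2) := by
    refine fun t v hv => Complex.norm_deriv_le_of_forall_mem_sphere_norm_le (half_pos hR)
      (DifferentiableOn.diffContOnCl ?_) fun w hw =>
        (hball (hsub v hv (sphere_subset_closedBall hw))).2 t
    rw [closure_ball v (half_pos hR).ne']
    exact (hd t).mono fun w hw => (hball (hsub v hv hw)).1
  have hm_nhds : ∀ᶠ u in 𝓝 u₀, AEStronglyMeasurable (F u) μ := by
    filter_upwards [hU.mem_nhds hu₀] with u hu using hm u hu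
  exact (hasDerivAt_integral_of_dominated_loc_of_deriv_le
    (ball_mem_nhds u₀ (half_pos hR)) hm_nhds
    (hh.mono' (hm u₀ hu₀) (Eventually.of_forall hbd.self_of_nhds))
    (aestronglyMeasurable_deriv_of_eventually hm_nhds
      fun t => hdiff t u₀ (mem_ball_self (half_pos hR)))
    (Eventually.of_forall hderiv) (hh.div_const (R / 2))
    (Eventually.of_forall fun t v hv =>
      (hdiff t v hv).hasDerivAt)).2.differentiableAt.differentiableWithinAt

end ParametricIntegral

/-- The Gaussian probability density on `ℝ` with variance `1 / (2 r)`, extended to complex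
arguments; it is the kernel of `smear`. -/
def gauss (r : ℝ) (w : ℂ) : ℂ := (√(r / Real.pi) : ℝ) * Complex.exp (-(r : ℂ) * w ^ 2)

theorem differentiable_gauss (r : ℝ) : Differentiable ℂ (gauss r) := by
  unfold gauss
  fun_prop

theorem norm_gauss (r : ℝ) (w : ℂ) :
    ‖gauss r w‖ = √(r / Real.pi) * Real.exp (-r * (w.re ^ 2 - w.im ^ 2)) := by
  rw [gauss, norm_mul, Complex.norm_real, Real.norm_of_nonneg (Real.sqrt_nonneg _),
    Complex.norm_exp]
  congr 2
  simp [pow_two]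

theorem norm_gauss_ofReal (r t : ℝ) :
    ‖gauss r t‖ = √(r / Real.pi) * Real.exp (-r * t ^ 2) := by
  simp [norm_gauss]

theorem norm_gauss_sub_le {r : ℝ} (hr : 0 < r) (t : ℝ) (u : ℂ) :
    ‖gauss r (t - u)‖ ≤
      √(r / Real.pi) * Real.exp (r * ‖u‖ ^ 2) * Real.exp (-(r / 2) * t ^ 2) := by
  rw [norm_gauss, mul_assoc, ← Real.exp_add, Complex.sq_norm, Complex.normSq_apply]
  gcongr
  simp only [Complex.sub_re, Complex.ofReal_re, Complex.sub_im, Complex.ofReal_im]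
  nlinarith [mul_nonneg hr.le (sq_nonneg (t - 2 * u.re))]

theorem continuous_gauss_sub (r : ℝ) (u : ℂ) : Continuous fun t : ℝ => gauss r (t - u) :=
  (differentiable_gauss r).continuous.comp (by fun_prop)

theorem integrable_gauss_sub {r : ℝ} (hr : 0 < r) (u : ℂ) :
    Integrable fun t : ℝ => gauss r (t - u) :=
  Integrable.mono' ((integrable_exp_neg_mul_sq (half_pos hr)).const_mul
    (√(r / Real.pi) * Real.exp (r * ‖u‖ ^ 2))) (continuous_gauss_sub r u).aestronglyMeasurable
    (Eventually.of_forall fun t => norm_gauss_sub_le hr t u)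

theorem integrable_gauss {r : ℝ} (hr : 0 < r) : Integrable fun t : ℝ => gauss r t := by
  simpa using integrable_gauss_sub hr 0

theorem integral_norm_gauss {r : ℝ} (hr : 0 < r) : ∫ t : ℝ, ‖gauss r t‖ = 1 := by
  simp_rw [norm_gauss_ofReal, integral_const_mul, integral_gaussian]
  rw [← Real.sqrt_mul (by positivity), div_mul_div_cancel₀ Real.pi_ne_zero, div_self hr.ne',
    Real.sqrt_one]

theorem integral_gauss {r : ℝ} (hr : 0 < r) : ∫ t : ℝ, gauss r t = 1 := by
  have hnorm : ∀ t : ℝ, gauss r t = (‖gauss r t‖ : ℝ) := fun t => by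
    rw [norm_gauss_ofReal, gauss]
    push_cast
    rfl
  rw [integral_congr_ae (Eventually.of_forall hnorm), integral_complex_ofReal,
    integral_norm_gauss hr, Complex.ofReal_one]

theorem gauss_sqrt_mul {r : ℝ} (hr : 0 < r) (t : ℝ) :
    √r * gauss 1 (√r * t : ℝ) = gauss r t := by
  have hsq : ((√r : ℝ) : ℂ) ^ 2 = r := by exact_mod_cast Real.sq_sqrt hr.le
  rw [gauss, gauss, ← mul_assoc, ← Complex.ofReal_mul, ← Real.sqrt_mul hr.le, mul_one_div]
  push_cast
  rw [mul_pow, hsq]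
  ring_nf

section Smear

variable {E F : Type*} [NormedAddCommGroup E] [NormedSpace ℂ E] [NormedAddCommGroup F]
  [NormedSpace ℂ F] {r M : ℝ} {φ : ℝ → E}

/-- The convolution of `φ` with the Gaussian density, evaluated at a complex point. For a bounded
continuous `φ` it is entire in that point and approximates `φ` on the real axis as `r → ∞`. -/
def smear (r : ℝ) (φ : ℝ → E) (u : ℂ) : E := ∫ t : ℝ, gauss r (t - u) • φ t

theorem integrable_gauss_smul (hr : 0 < r) (hφ : Continuous φ) (hM : ∀ t, ‖φ t‖ ≤ M) (u : ℂ) :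
    Integrable fun t : ℝ => gauss r (t - u) • φ t :=
  (integrable_gauss_sub hr u).smul_bdd M hφ.aestronglyMeasurable (Eventually.of_forall hM)

theorem smear_add_ofReal (r : ℝ) (φ : ℝ → E) (u : ℂ) (s : ℝ) :
    smear r φ (u + s) = smear r (fun t => φ (t + s)) u := by
  rw [smear, ← integral_add_right_eq_self _ s, smear]
  congr 1 with t
  push_cast
  congr 2
  ring

theorem smear_zero (r : ℝ) (φ : ℝ → E) : smear r φ 0 = ∫ t : ℝ, gauss r t • φ t := by
  simp [smear]

theorem smear_ofReal (r : ℝ) (φ : ℝ → E) (s : ℝ) :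
    smear r φ s = ∫ t : ℝ, gauss r t • φ (t + s) := by
  simpa [smear_zero] using smear_add_ofReal r φ 0 s

theorem map_smear [CompleteSpace E] [CompleteSpace F] (L : E →L[ℂ] F) (hr : 0 < r)
    (hφ : Continuous φ) (hM : ∀ t, ‖φ t‖ ≤ M) (u : ℂ) :
    L (smear r φ u) = smear r (fun t => L (φ t)) u := by
  rw [smear, ← L.integral_comp_comm (integrable_gauss_smul hr hφ hM u)]
  simp [smear]

theorem smear_sub (hr : 0 < r) (hφ : Continuous φ) (hM : ∀ t, ‖φ t‖ ≤ M) {ψ : ℝ → E}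
    {M' : ℝ} (hψ : Continuous ψ) (hM' : ∀ t, ‖ψ t‖ ≤ M') (u : ℂ) :
    smear r (fun t => φ t - ψ t) u = smear r φ u - smear r ψ u := by
  simp only [smear, smul_sub]
  exact integral_sub (integrable_gauss_smul hr hφ hM u) (integrable_gauss_smul hr hψ hM' u)

theorem norm_smear_le (hr : 0 < r) (hM : ∀ t, ‖φ t‖ ≤ M) (u : ℂ) :
    ‖smear r φ u‖ ≤ Real.exp (r * u.im ^ 2) * M := by
  have h_kernel : ∀ t : ℝ, ‖gauss r (t - u.im * Complex.I)‖ =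
      Real.exp (r * u.im ^ 2) * ‖gauss r t‖ := fun t => by
    rw [norm_gauss, norm_gauss_ofReal, mul_left_comm, ← Real.exp_add]
    congr 2
    simp
    ring
  have hu : smear r φ u = smear r (fun t => φ (t + u.re)) (u.im * Complex.I) := by
    rw [← smear_add_ofReal, add_comm, Complex.re_add_im]
  calc ‖smear r φ u‖ ≤ ∫ t : ℝ, Real.exp (r * u.im ^ 2) * ‖gauss r t‖ * M := by
        rw [hu]
        refine norm_integral_le_of_norm_le
          (((integrable_gauss hr).norm.const_mul _).mul_const _) (Eventually.of_forall fun t => ?_)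
        rw [norm_smul, h_kernel]
        gcongr
        exact hM _
    _ = Real.exp (r * u.im ^ 2) * M := by
        rw [integral_mul_const, integral_const_mul, integral_norm_gauss hr, mul_one]

theorem norm_smear_ofReal_le (hr : 0 < r) (hM : ∀ t, ‖φ t‖ ≤ M) (s : ℝ) :
    ‖smear r φ s‖ ≤ M := by
  simpa using norm_smear_le hr hM (s : ℂ)

section Analytic

variable {p : ℂ → ℂ} {Φ : ℂ → ℝ → E}

theorem norm_gauss_smul_le (hr : 0 < r) (hM : ∀ t, ‖φ t‖ ≤ M) {w : ℂ} {R : ℝ} (hw : ‖w‖ ≤ R)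
    (t : ℝ) : ‖gauss r (t - w) • φ t‖ ≤
      √(r / Real.pi) * Real.exp (r * R ^ 2) * Real.exp (-(r / 2) * t ^ 2) * M := by
  rw [norm_smul]
  gcongr
  · exact (norm_gauss_sub_le hr t w).trans (by gcongr)
  · exact hM t

theorem integrable_gaussian_bound (hr : 0 < r) (C M : ℝ) :
    Integrable fun t : ℝ => C * Real.exp (-(r / 2) * t ^ 2) * M :=
  ((integrable_exp_neg_mul_sq (half_pos hr)).const_mul _).mul_const _

theorem eventually_norm_le_add_one (hp : Continuous p) (u₀ : ℂ) :
    ∀ᶠ u in 𝓝 u₀, ‖p u‖ ≤ ‖p u₀‖ + 1 :=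
  (hp.norm.tendsto u₀).eventually (ge_mem_nhds (lt_add_one _))

theorem continuousOn_smear (hr : 0 < r) (hp : Continuous p) {S : Set ℂ}
    (hc : ∀ u ∈ S, Continuous (Φ u)) (hM : ∀ u ∈ S, ∀ t, ‖Φ u t‖ ≤ M)
    (hS : ∀ t, ContinuousOn (fun u => Φ u t) S) :
    ContinuousOn (fun u => smear r (Φ u) (p u)) S := by
  intro u₀ hu₀
  refine continuousWithinAt_of_dominated ?_ ?_
    (integrable_gaussian_bound hr (√(r / Real.pi) * Real.exp (r * (‖p u₀‖ + 1) ^ 2)) M) ?_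
  · filter_upwards [self_mem_nhdsWithin] with u hu
    exact ((continuous_gauss_sub r _).smul (hc u hu)).aestronglyMeasurable
  · filter_upwards [self_mem_nhdsWithin,
      nhdsWithin_le_nhds (eventually_norm_le_add_one hp u₀)] with u hu hpu
    exact Eventually.of_forall (norm_gauss_smul_le hr (hM u hu) hpu)
  · refine Eventually.of_forall fun t => ContinuousWithinAt.smul ?_ (hS t u₀ hu₀)
    exact ((differentiable_gauss r).continuous.comp (by fun_prop)).continuousWithinAt

theorem differentiableOn_smear (hr : 0 < r) (hp : Differentiable ℂ p) {U : Set ℂ}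
    (hU : IsOpen U) (hc : ∀ u ∈ U, Continuous (Φ u)) (hM : ∀ u ∈ U, ∀ t, ‖Φ u t‖ ≤ M)
    (hd : ∀ t, DifferentiableOn ℂ (fun u => Φ u t) U) :
    DifferentiableOn ℂ (fun u => smear r (Φ u) (p u)) U := by
  refine differentiableOn_integral_of_dominated hU
    (fun u hu => ((continuous_gauss_sub r _).smul (hc u hu)).aestronglyMeasurable)
    (fun t => ((differentiable_gauss r).comp
      ((differentiable_const _).sub hp)).differentiableOn.smul (hd t))
    fun u₀ _ => ⟨_, integrable_gaussian_bound hr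
      (√(r / Real.pi) * Real.exp (r * (‖p u₀‖ + 1) ^ 2)) M, ?_⟩
  filter_upwards [hU.mem_nhds ‹_›, eventually_norm_le_add_one hp.continuous u₀] with u hu hpu
  exact norm_gauss_smul_le hr (hM u hu) hpu

theorem isStripAnalytic_smear {z : ℂ} (hr : 0 < r) (hp : Differentiable ℂ p)
    (hc : ∀ u ∈ strip z, Continuous (Φ u)) (hM : ∀ u ∈ strip z, ∀ t, ‖Φ u t‖ ≤ M)
    (hΦ : ∀ t, IsStripAnalytic (fun u => Φ u t) z) :
    IsStripAnalytic (fun u => smear r (Φ u) (p u)) z where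
  continuousOn := continuousOn_smear hr hp.continuous hc hM fun t => (hΦ t).continuousOn
  differentiableOn := differentiableOn_smear hr hp isOpen_interior
    (fun u hu => hc u (interior_subset hu)) (fun u hu => hM u (interior_subset hu))
    fun t => (hΦ t).differentiableOn

theorem isStripAnalytic_smear_const (hr : 0 < r) (hφ : Continuous φ) (hM : ∀ t, ‖φ t‖ ≤ M)
    (z : ℂ) : IsStripAnalytic (smear r φ) z :=
  isStripAnalytic_smear (Φ := fun _ => φ) hr differentiable_id (fun _ _ => hφ) (fun _ _ => hM)
    fun _ => .of_differentiable (differentiable_const _)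

theorem IsStripAnalytic.smear_eq_smear_shift [CompleteSpace E] {f : ℂ → E} {z : ℂ} (hr : 0 < r)
    (hf : IsStripAnalytic f z) (hM : ∀ u ∈ strip z, ‖f u‖ ≤ M) :
    smear r (fun t => f t) z = smear r (fun t => f (z + t)) 0 := by
  refine IsStripAnalytic.eqOn (f := smear r fun t => f t)
    (g := fun u => smear r (fun t => f (u + t)) 0)
    (isStripAnalytic_smear_const hr hf.continuous_ofReal (fun t => hM _ (ofReal_mem_strip z t)) z)
    (isStripAnalytic_smear hr (differentiable_const 0) (fun u => hf.continuous_line)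
      (fun u hu t => hM _ (add_ofReal_mem_strip hu t)) hf.comp_add_ofReal) (fun s => ?_)
    (self_mem_strip z)
  rw [smear_ofReal, smear_zero]
  simp [add_comm]

theorem smear_const [CompleteSpace E] (hr : 0 < r) (x : E) (u : ℂ) :
    smear r (fun _ => x) u = x := by
  have h_shift := (IsStripAnalytic.of_differentiable (z := u)
    (differentiable_const x)).smear_eq_smear_shift hr fun _ _ => le_rfl
  rw [h_shift, smear_zero, integral_smul_const, integral_gauss hr, one_smul]

end Analytic

section Approximation

theorem smear_ofReal_eq_integral_gauss_one (hr : 0 < r) (φ : ℝ → E) (x : ℝ) :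
    smear r φ x = ∫ s : ℝ, gauss 1 s • φ (s / √r + x) := by
  have hsqrt : √r ≠ 0 := (Real.sqrt_pos.2 hr).ne'
  have hsubst := Measure.integral_comp_mul_left (fun s : ℝ => gauss 1 s • φ (s / √r + x)) √r
  rw [abs_of_pos (inv_pos.2 (Real.sqrt_pos.2 hr)), eq_inv_smul_iff₀ hsqrt, ← integral_smul]
    at hsubst
  rw [smear_ofReal, ← hsubst]
  congr 1 with t
  rw [mul_div_cancel_left₀ t hsqrt, ← gauss_sqrt_mul hr, mul_smul, Complex.coe_smul]

theorem tendstoLocallyUniformly_smear [CompleteSpace E] (hφ : Continuous φ)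
    (hM : ∀ t, ‖φ t‖ ≤ M) :
    TendstoLocallyUniformly (fun (r : ℝ) (x : ℝ) => smear r φ x) φ atTop := by
  rw [tendstoLocallyUniformly_iff_forall_tendsto]
  intro x
  have hpoint : Tendsto (fun q : ℝ × ℝ => smear q.1 φ q.2) (atTop ×ˢ 𝓝 x) (𝓝 (φ x)) := by
    have hlim : Tendsto (fun q : ℝ × ℝ => ∫ s : ℝ, gauss 1 s • φ (s / √q.1 + q.2))
        (atTop ×ˢ 𝓝 x) (𝓝 (∫ s : ℝ, gauss 1 s • φ x)) := by
      refine tendsto_integral_filter_of_dominated_convergence (fun s : ℝ => ‖gauss 1 s‖ * M)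
        (Eventually.of_forall fun q => ?_) (Eventually.of_forall fun q =>
          Eventually.of_forall fun s => ?_) ((integrable_gauss one_pos).norm.mul_const M)
        (Eventually.of_forall fun s => ?_)
      · exact (integrable_gauss one_pos).aestronglyMeasurable.smul
          (by fun_prop : Continuous fun s : ℝ => φ (s / √q.1 + q.2)).aestronglyMeasurable
      · rw [norm_smul]
        gcongr
        exact hM _
      · refine ((hφ.tendsto x).comp ?_).const_smul _
        simpa using ((tendsto_const_nhds (x := s)).div_atTop
          (Real.tendsto_sqrt_atTop.comp tendsto_fst)).add tendsto_snd
    rw [integral_smul_const, integral_gauss one_pos, one_smul] at hlim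
    refine hlim.congr' ?_
    filter_upwards [tendsto_fst.eventually (eventually_gt_atTop (0 : ℝ))] with q hq
    exact (smear_ofReal_eq_integral_gauss_one hq φ q.2).symm
  exact (((hφ.tendsto x).comp tendsto_snd).prodMk_nhds hpoint).mono_right
    (nhds_le_uniformity (φ x))

theorem tendsto_smear_ofReal [CompleteSpace E] (hφ : Continuous φ) (hM : ∀ t, ‖φ t‖ ≤ M)
    (x : ℝ) : Tendsto (fun r : ℝ => smear r φ x) atTop (𝓝 (φ x)) :=
  (tendstoLocallyUniformlyOn_univ.2 (tendstoLocallyUniformly_smear hφ hM)).tendsto_at (mem_univ x)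

theorem tendsto_smear_zero [CompleteSpace E] (hφ : Continuous φ) (hM : ∀ t, ‖φ t‖ ≤ M) :
    Tendsto (fun r : ℝ => smear r φ 0) atTop (𝓝 (φ 0)) := by
  simpa using tendsto_smear_ofReal hφ hM 0

end Approximation

end Smear

/-! ### Analytic extension to a strip from Gaussian smearing -/

section UniformLimits

variable {E ι : Type*} [NormedAddCommGroup E] [NormedSpace ℂ E] {l : Filter ι}

theorem tendstoUniformly_smul_of_tendsto_cocompact {X : Type*} [TopologicalSpace X] {w : X → ℂ}
    (hw : Continuous w) (hw₀ : Tendsto w (cocompact X) (𝓝 0)) {f : ι → X → E} {g : X → E} {M : ℝ}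
    (hfg : TendstoLocallyUniformly f g l) (hf : ∀ᶠ i in l, ∀ x, ‖f i x‖ ≤ M)
    (hg : ∀ x, ‖g x‖ ≤ M) :
    TendstoUniformly (fun i x => w x • f i x) (fun x => w x • g x) l := by
  rw [Metric.tendstoUniformly_iff]
  intro ε hε
  have h_tail : ∀ᶠ x in cocompact X, ‖w x‖ * (M + M) < ε := by
    have := (hw₀.norm.mul_const (M + M)).eventually (gt_mem_nhds (by simpa using hε))
    exact this
  obtain ⟨K, hK, hKε⟩ := mem_cocompact.1 h_tail
  obtain ⟨W, hW⟩ := hK.exists_bound_of_continuousOn hw.continuousOn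
  have hfg_K := (tendstoLocallyUniformlyOn_iff_tendstoUniformlyOn_of_compact hK).1
    hfg.tendstoLocallyUniformlyOn
  filter_upwards [hf, Metric.tendstoUniformlyOn_iff.1 hfg_K (ε / (|W| + 1)) (by positivity)]
    with i hfi hKi x
  rw [dist_eq_norm, ← smul_sub, norm_smul]
  by_cases hx : x ∈ K
  · have hWx : ‖w x‖ < |W| + 1 := by linarith [hW x hx, le_abs_self W]
    calc ‖w x‖ * ‖g x - f i x‖ ≤ ‖w x‖ * (ε / (|W| + 1)) := by
          rw [← dist_eq_norm]
          gcongr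
          exact (hKi x hx).le
      _ < (|W| + 1) * (ε / (|W| + 1)) := by gcongr
      _ = ε := by field_simp
  · calc ‖w x‖ * ‖g x - f i x‖ ≤ ‖w x‖ * (M + M) := by
          gcongr
          exact (norm_sub_le _ _).trans (add_le_add (hg x) (hfi x))
      _ < ε := hKε hx

theorem uniformCauchySeqOn_strip_of_boundary {f : ι → ℂ → E} {z : ℂ}
    (hf : ∀ᶠ i in l, IsStripAnalytic (f i) z) (hb : ∀ᶠ i in l, ∃ K, ∀ u ∈ strip z, ‖f i u‖ ≤ K)
    (h₀ : UniformCauchySeqOn (fun i (x : ℝ) => f i x) l univ)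
    (h₁ : UniformCauchySeqOn (fun i (x : ℝ) => f i (z + x)) l univ) :
    UniformCauchySeqOn f l (strip z) := by
  have h_dist : ∀ {X : Type} {g : ι → X → E} {s : Set X}, UniformCauchySeqOn g l s ↔
      ∀ ε > 0, ∀ᶠ m in l ×ˢ l, ∀ x ∈ s, ‖g m.1 x - g m.2 x‖ ≤ ε := fun {X g s} => by
    simp_rw [← dist_eq_norm]
    exact Metric.uniformity_basis_dist_le.forall_iff fun V W hVW hV => hV.mono
      fun m hm x hx => hVW (hm x hx)
  rw [h_dist] at h₀ h₁ ⊢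
  intro ε hε
  filter_upwards [h₀ ε hε, h₁ ε hε, hf.prod_mk hf, hb.prod_mk hb] with m h₀m h₁m hfm hbm u hu
  obtain ⟨⟨K₁, hK₁⟩, K₂, hK₂⟩ := hbm
  have h_sub : IsStripAnalytic (fun u => f m.1 u - f m.2 u) z :=
    ⟨hfm.1.continuousOn.sub hfm.2.continuousOn, hfm.1.differentiableOn.sub hfm.2.differentiableOn⟩
  exact h_sub.norm_le_of_boundary
    (fun v hv => (norm_sub_le _ _).trans (add_le_add (hK₁ v hv) (hK₂ v hv)))
    (fun x => h₀m x (mem_univ x)) (fun x => h₁m x (mem_univ x)) hu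

end UniformLimits

section StripExtension

variable {E : Type*} [NormedAddCommGroup E] [NormedSpace ℂ E]

theorem norm_cexp_neg_sq (u : ℂ) :
    ‖Complex.exp (-u ^ 2)‖ = Real.exp (-u.re ^ 2) * Real.exp (u.im ^ 2) := by
  rw [Complex.norm_exp, ← Real.exp_add]
  congr 1
  simp [pow_two]
  ring

theorem norm_cexp_neg_sq_le_of_mem_strip {z u : ℂ} (hu : u ∈ strip z) :
    ‖Complex.exp (-u ^ 2)‖ ≤ Real.exp (z.im ^ 2) := by
  have h_im := im_sq_le_of_mem_strip hu
  rw [norm_cexp_neg_sq]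
  calc Real.exp (-u.re ^ 2) * Real.exp (u.im ^ 2) ≤ 1 * Real.exp (z.im ^ 2) := by
        gcongr
        exact Real.exp_le_one_iff.2 (neg_nonpos.2 (sq_nonneg _))
    _ = Real.exp (z.im ^ 2) := one_mul _

theorem tendsto_cexp_neg_add_sq_cocompact (v : ℂ) :
    Tendsto (fun x : ℝ => Complex.exp (-(v + x) ^ 2)) (cocompact ℝ) (𝓝 0) := by
  have h_sq : Tendsto (fun x : ℝ => Real.exp (-x ^ 2)) (cocompact ℝ) (𝓝 0) := by
    simpa using tendsto_rpow_abs_mul_exp_neg_mul_sq_cocompact one_pos 0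
  have h_shift := h_sq.comp (Homeomorph.addLeft v.re).isClosedEmbedding.tendsto_cocompact
  rw [tendsto_zero_iff_norm_tendsto_zero]
  simpa [norm_cexp_neg_sq, Function.comp_def] using h_shift.mul_const (Real.exp (v.im ^ 2))

variable {φ ψ : ℝ → E} {M : ℝ} {z : ℂ}

theorem norm_smear_le_of_smear_eq {r : ℝ} (hr : 0 < r) (hφ : Continuous φ) (hM : ∀ t, ‖φ t‖ ≤ M)
    (hM' : ∀ t, ‖ψ t‖ ≤ M) (h : ∀ x : ℝ, smear r φ (z + x) = smear r ψ x) {u : ℂ}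
    (hu : u ∈ strip z) : ‖smear r φ u‖ ≤ M := by
  have hM0 : 0 ≤ M := (norm_nonneg _).trans (hM 0)
  refine (isStripAnalytic_smear_const hr hφ hM z).norm_le_of_boundary
    (K := Real.exp (r * z.im ^ 2) * M) (fun v hv => (norm_smear_le hr hM v).trans ?_)
    (norm_smear_ofReal_le hr hM) (fun x => (h x).symm ▸ norm_smear_ofReal_le hr hM' x) hu
  have h_im := im_sq_le_of_mem_strip hv
  gcongr

/-- The factor `exp (-u ^ 2)` turns the locally uniform convergence of the smearings on the two
boundary lines into uniform convergence. -/
theorem uniformCauchySeqOn_cexp_smul_smear [CompleteSpace E] (hφ : Continuous φ)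
    (hψ : Continuous ψ) (hM : ∀ t, ‖φ t‖ ≤ M) (hM' : ∀ t, ‖ψ t‖ ≤ M)
    (h : ∀ r : ℝ, 0 < r → ∀ x : ℝ, smear r φ (z + x) = smear r ψ x) :
    UniformCauchySeqOn (fun r u => Complex.exp (-u ^ 2) • smear r φ u) atTop (strip z) := by
  have h_line : ∀ (v : ℂ) {χ : ℝ → E}, Continuous χ → (∀ t, ‖χ t‖ ≤ M) →
      TendstoUniformlyOn (fun r (x : ℝ) => Complex.exp (-(v + x) ^ 2) • smear r χ x)
        (fun x => Complex.exp (-(v + x) ^ 2) • χ x) atTop univ :=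
    fun v χ hχ hχM => tendstoUniformlyOn_univ.2 <|
      tendstoUniformly_smul_of_tendsto_cocompact (by fun_prop)
        (tendsto_cexp_neg_add_sq_cocompact v) (tendstoLocallyUniformly_smear hχ hχM)
        ((eventually_gt_atTop 0).mono fun r hr => norm_smear_ofReal_le hr hχM) hχM
  refine uniformCauchySeqOn_strip_of_boundary ?_ ?_
    (by simpa using (h_line 0 hφ hM).uniformCauchySeqOn) ?_
  · filter_upwards [eventually_gt_atTop 0] with r hr
    exact (isStripAnalytic_smear_const hr hφ hM z).smul (by fun_prop)
  · filter_upwards [eventually_gt_atTop 0] with r hr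
    refine ⟨Real.exp (z.im ^ 2) * M, fun u hu => ?_⟩
    rw [norm_smul]
    gcongr
    · exact norm_cexp_neg_sq_le_of_mem_strip hu
    · exact norm_smear_le_of_smear_eq hr hφ hM hM' (h r hr) hu
  · refine ((h_line z hψ hM').congr ?_).uniformCauchySeqOn
    filter_upwards [eventually_gt_atTop 0] with r hr x _
    simp only [h r hr]

theorem exists_isStripAnalytic_tendsto_smear [CompleteSpace E] (hφ : Continuous φ)
    (hψ : Continuous ψ) (hM : ∀ t, ‖φ t‖ ≤ M) (hM' : ∀ t, ‖ψ t‖ ≤ M)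
    (h : ∀ r : ℝ, 0 < r → ∀ x : ℝ, smear r φ (z + x) = smear r ψ x) :
    ∃ f : ℂ → E, IsStripAnalytic f z ∧
      ∀ u ∈ strip z, Tendsto (fun r => smear r φ u) atTop (𝓝 (f u)) := by
  have h_cauchy := uniformCauchySeqOn_cexp_smul_smear hφ hψ hM hM' h
  have h_an : ∀ᶠ r : ℝ in atTop, IsStripAnalytic (fun u => Complex.exp (-u ^ 2) • smear r φ u) z :=
    (eventually_gt_atTop 0).mono fun r hr =>
      (isStripAnalytic_smear_const hr hφ hM z).smul (by fun_prop)
  choose! g hg using fun u hu =>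
    cauchy_map_iff_exists_tendsto.1 (h_cauchy.cauchy_map (x := u) hu)
  have h_unif := h_cauchy.tendstoUniformlyOn_of_tendsto hg
  have hg_an : IsStripAnalytic g z :=
    ⟨h_unif.continuousOn (h_an.mono fun r hr => hr.continuousOn).frequently,
      (h_unif.mono interior_subset).tendstoLocallyUniformlyOn.differentiableOn
        (h_an.mono fun r hr => hr.differentiableOn) isOpen_interior⟩
  refine ⟨fun u => Complex.exp (u ^ 2) • g u, hg_an.smul (by fun_prop), fun u hu => ?_⟩
  refine ((hg u hu).const_smul (Complex.exp (u ^ 2))).congr fun r => ?_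
  rw [smul_smul, ← Complex.exp_add, add_neg_cancel, Complex.exp_zero, one_smul]

theorem exists_isStripAnalytic_of_smear_eq [CompleteSpace E] (hφ : Continuous φ)
    (hψ : Continuous ψ) (hM : ∀ t, ‖φ t‖ ≤ M) (hM' : ∀ t, ‖ψ t‖ ≤ M)
    (h : ∀ r : ℝ, 0 < r → ∀ x : ℝ, smear r φ (z + x) = smear r ψ x) :
    ∃ f : ℂ → E, IsStripAnalytic f z ∧ (∀ u ∈ strip z, ‖f u‖ ≤ M) ∧ (∀ t : ℝ, f t = φ t) ∧
      ∀ t : ℝ, f (z + t) = ψ t := by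
  obtain ⟨f, hf, hlim⟩ := exists_isStripAnalytic_tendsto_smear hφ hψ hM hM' h
  refine ⟨f, hf, fun u hu => ?_, fun t => ?_, fun t => ?_⟩
  · exact le_of_tendsto (hlim u hu).norm ((eventually_gt_atTop 0).mono fun r hr =>
      norm_smear_le_of_smear_eq hr hφ hM hM' (h r hr) hu)
  · exact tendsto_nhds_unique (hlim t (ofReal_mem_strip z t)) (tendsto_smear_ofReal hφ hM t)
  · refine tendsto_nhds_unique (hlim _ (add_ofReal_mem_strip (self_mem_strip z) t))
      ((tendsto_smear_ofReal hψ hM' t).congr' ?_)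
    filter_upwards [eventually_gt_atTop 0] with r hr
    exact (h r hr t).symm

end StripExtension

/-! ### Strongly continuous families of operators -/

section StrongContinuity

variable {E F : Type*} [NormedAddCommGroup E] [NormedSpace ℂ E] [NormedAddCommGroup F]
  [NormedSpace ℂ F]

theorem tendsto_clm_apply_of_norm_le {ι : Type*} {l : Filter ι} {T : ι → E →L[ℂ] F} {v : ι → E}
    {x : E} {y : F} {M : ℝ} (hM : ∀ᶠ i in l, ‖T i‖ ≤ M) (hT : Tendsto (fun i => T i x) l (𝓝 y))
    (hv : Tendsto v l (𝓝 x)) : Tendsto (fun i => T i (v i)) l (𝓝 y) := by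
  have h_diff : Tendsto (fun i => T i (v i - x)) l (𝓝 0) :=
    squeeze_zero_norm' (hM.mono fun i hi => (T i).le_of_opNorm_le hi _)
      (by simpa using (tendsto_iff_norm_sub_tendsto_zero.1 hv).const_mul M)
  simpa using h_diff.add hT

theorem continuousOn_clm_apply_of_forall [CompleteSpace E] {X : Type*} [TopologicalSpace X]
    [WeaklyLocallyCompactSpace X] {S : Set X} (hS : IsClosed S) {T : X → E →L[ℂ] F} {v : X → E}
    (hT : ∀ x, ContinuousOn (fun u => T u x) S) (hv : ContinuousOn v S) :
    ContinuousOn (fun u => T u (v u)) S := by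
  intro u hu
  obtain ⟨K, hK, hKu⟩ := exists_compact_mem_nhds u
  obtain ⟨M, hM⟩ := banach_steinhaus (g := fun w : ↥(K ∩ S) => T w) fun x => by
    obtain ⟨C, hC⟩ := (hK.inter_right hS).exists_bound_of_continuousOn
      ((hT x).mono inter_subset_right)
    exact ⟨C, fun w => hC w w.2⟩
  refine tendsto_clm_apply_of_norm_le (M := M) ?_ (hT (v u) u hu) (hv u hu)
  filter_upwards [mem_nhdsWithin_of_mem_nhds hKu, self_mem_nhdsWithin] with w hwK hwS
  exact hM ⟨w, hwK, hwS⟩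

variable {T : ℝ → E →L[ℂ] F} {r M : ℝ}

/-- The operator `x ↦ ∫ gauss r (t - u) • T t x dt` obtained by Gaussian smearing of a bounded
strongly continuous family of operators. It is a bounded operator although `t ↦ T t` need not be
continuous, nor measurable, for the operator norm. -/
def smearCLM (hr : 0 < r) (hT : ∀ x, Continuous fun t => T t x) (hM : ∀ t x, ‖T t x‖ ≤ M * ‖x‖)
    (u : ℂ) : E →L[ℂ] F :=
  LinearMap.mkContinuous
    { toFun := fun x => smear r (fun t => T t x) u
      map_add' := fun x y => by
        simp only [smear, map_add, smul_add]
        exact integral_add (integrable_gauss_smul hr (hT x) (hM · x) u)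
          (integrable_gauss_smul hr (hT y) (hM · y) u)
      map_smul' := fun c x => by
        simp only [smear, map_smul, RingHom.id_apply, ← integral_smul, smul_comm c] }
    (Real.exp (r * u.im ^ 2) * M) fun x => (norm_smear_le hr (hM · x) u).trans_eq (by ring)

theorem smearCLM_apply (hr : 0 < r) (hT : ∀ x, Continuous fun t => T t x)
    (hM : ∀ t x, ‖T t x‖ ≤ M * ‖x‖) (u : ℂ) (x : E) :
    smearCLM hr hT hM u x = smear r (fun t => T t x) u :=
  rfl

theorem IsStripAnalytic.smear_clm_apply {f : ℂ → E} {z : ℂ} {p : ℂ → ℂ} {C : ℝ}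
    (hf : IsStripAnalytic f z) (hC : ∀ u ∈ strip z, ‖f u‖ ≤ C) (hr : 0 < r)
    (hT : ∀ x, Continuous fun t => T t x) (hM : ∀ t x, ‖T t x‖ ≤ M * ‖x‖)
    (hp : Differentiable ℂ p) :
    IsStripAnalytic (fun u => smear r (fun t => T t (f u)) (p u)) z :=
  isStripAnalytic_smear (M := |M| * C) hr hp (fun u _ => hT (f u))
    (fun u hu t => (hM t (f u)).trans
      (mul_le_mul (le_abs_self M) (hC u hu) (norm_nonneg _) (abs_nonneg M)))
    fun t => hf.clm_comp (T t)

end StrongContinuity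

/-! ### One-parameter representations and their norm continuations -/

section Rep

variable {E : Type*} [NormedAddCommGroup E] [NormedSpace ℂ E] {α β : ℝ → E →L[ℂ] E}

theorem IsRep.add_apply (h : IsRep α) (s t : ℝ) (a : E) : α (s + t) a = α s (α t a) :=
  DFunLike.congr_fun (h.add s t) a

theorem IsRep.zero_apply (h : IsRep α) (a : E) : α 0 a = a :=
  DFunLike.congr_fun h.zero a

theorem IsRep.neg_apply (h : IsRep α) (t : ℝ) (a : E) : α (-t) (α t a) = a := by
  rw [← h.add_apply, neg_add_cancel, h.zero_apply]

theorem IsRep.norm_apply_le (h : IsRep α) (t : ℝ) (a : E) : ‖α t a‖ ≤ ‖a‖ := by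
  simpa using (α t).le_of_opNorm_le (h.norm_le t) a

theorem IsRep.continuous_comp (h : IsRep α) {v : ℝ → E} (hv : Continuous v) :
    Continuous fun t => α t (v t) :=
  continuous_iff_continuousAt.2 fun t => tendsto_clm_apply_of_norm_le
    (Eventually.of_forall h.norm_le) (h.continuous (v t)).continuousAt hv.continuousAt

theorem IsRep.comp (hα : IsRep α) (hβ : IsRep β)
    (hcomm : ∀ s t x, α s (β t x) = β t (α s x)) : IsRep fun t => α t ∘L β t where
  add s t := by
    ext x
    simp only [ContinuousLinearMap.comp_apply]
    rw [hα.add_apply, hβ.add_apply, ← hcomm t s]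
  zero := by
    ext x
    simp [hα.zero_apply, hβ.zero_apply]
  norm_le t := (ContinuousLinearMap.opNorm_comp_le _ _).trans
    (mul_le_one₀ (hα.norm_le t) (norm_nonneg _) (hβ.norm_le t))
  continuous a := hα.continuous_comp (hβ.continuous a)

theorem mem_contGraph_iff_exists_isStripAnalytic [CompleteSpace E] {z : ℂ} {p : E × E} :
    p ∈ contGraph α z ↔
      ∃ f : ℂ → E, IsStripAnalytic f z ∧ (∀ t : ℝ, f t = α t p.1) ∧ f z = p.2 :=
  ⟨fun ⟨f, hc, ha, hα, hz⟩ => ⟨f, ⟨hc, ha.differentiableOn⟩, hα, hz⟩,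
    fun ⟨f, hf, hα, hz⟩ =>
      ⟨f, hf.continuousOn, hf.differentiableOn.analyticOnNhd isOpen_interior, hα, hz⟩⟩

theorem eq_of_mem_contGraph {z : ℂ} {a b b' : E} (hb : (a, b) ∈ contGraph α z)
    (hb' : (a, b') ∈ contGraph α z) : b = b' := by
  rw [← cont_graph] at hb hb'
  exact LinearPMap.mem_graph_snd_inj _ hb hb' rfl

variable [CompleteSpace E] {z : ℂ} {a b x y w : E} {r : ℝ}

theorem apply_mem_contGraph_of_comm {T : E →L[ℂ] E} (hT : ∀ t x, T (α t x) = α t (T x))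
    (hab : (a, b) ∈ contGraph α z) : (T a, T b) ∈ contGraph α z := by
  rw [mem_contGraph_iff_exists_isStripAnalytic] at hab ⊢
  obtain ⟨f, hf, hfα, rfl⟩ := hab
  exact ⟨fun u => T (f u), hf.clm_comp T, fun t => by simp only [hfα, hT], rfl⟩

namespace IsRep

theorem apply_mem_contGraph (h : IsRep α) (t : ℝ) (hab : (a, b) ∈ contGraph α z) :
    (α t a, α t b) ∈ contGraph α z :=
  apply_mem_contGraph_of_comm (fun s x => by rw [← h.add_apply, ← h.add_apply, add_comm]) hab

theorem exists_isStripAnalytic_of_mem_contGraph (h : IsRep α) (hab : (a, b) ∈ contGraph α z) :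
    ∃ (f : ℂ → E) (M : ℝ), IsStripAnalytic f z ∧ (∀ u ∈ strip z, ‖f u‖ ≤ M) ∧
      (∀ t : ℝ, f t = α t a) ∧ f z = b ∧ ∀ t : ℝ, f (z + t) = α t b := by
  obtain ⟨f, hf, hfα, hfz⟩ := mem_contGraph_iff_exists_isStripAnalytic.1 hab
  have h_shift : ∀ u ∈ strip z, ∀ t : ℝ, f (u + t) = α t (f u) := fun u hu t =>
    (hf.comp_add_ofReal t).eqOn (hf.clm_comp (α t))
      (fun s => by rw [← Complex.ofReal_add, hfα, hfα, add_comm, h.add_apply]) hu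
  have h_segment : ∀ y ∈ uIcc 0 z.im, (y * Complex.I : ℂ) ∈ strip z := fun y hy => by
    simpa [strip] using hy
  obtain ⟨M, hM⟩ := isCompact_uIcc.exists_bound_of_continuousOn
    (f := fun y : ℝ => f (y * Complex.I)) (hf.continuousOn.comp (by fun_prop) h_segment)
  refine ⟨f, M, hf, fun u hu => ?_, hfα, hfz, fun t => ?_⟩
  · rw [← Complex.re_add_im u, add_comm, h_shift _ (h_segment _ hu)]
    exact (h.norm_apply_le _ _).trans (hM _ hu)
  · rw [h_shift z (self_mem_strip z), hfz]

theorem smear_add (h : IsRep α) (hr : 0 < r) (a : E) (u : ℂ) (s : ℝ) :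
    smear r (fun t => α t a) (u + s) = α s (smear r (fun t => α t a) u) := by
  rw [smear_add_ofReal, map_smear (α s) hr (h.continuous a) (h.norm_apply_le · a)]
  simp only [add_comm _ s, h.add_apply]

theorem map_smear_of_comm (h : IsRep α) (hr : 0 < r) {T : E →L[ℂ] E}
    (hT : ∀ t x, T (α t x) = α t (T x)) (x : E) (u : ℂ) :
    T (smear r (fun t => α t x) u) = smear r (fun t => α t (T x)) u := by
  simp only [map_smear T hr (h.continuous x) (h.norm_apply_le · x), hT]

theorem tendsto_smear (h : IsRep α) (a : E) :
    Tendsto (fun r => smear r (fun t => α t a) 0) atTop (𝓝 a) := by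
  simpa only [h.zero_apply] using tendsto_smear_zero (h.continuous a) (h.norm_apply_le · a)

theorem smear_mem_contGraph (h : IsRep α) (hr : 0 < r) (a : E) (w z : ℂ) :
    (smear r (fun t => α t a) w, smear r (fun t => α t a) (w + z)) ∈ contGraph α z := by
  refine mem_contGraph_iff_exists_isStripAnalytic.2
    ⟨fun u => smear r (fun t => α t a) (w + u), ?_, fun t => h.smear_add hr a w t, rfl⟩
  exact isStripAnalytic_smear hr (differentiable_id.const_add w) (fun _ _ => h.continuous a)
    (fun _ _ => (h.norm_apply_le · a)) fun t => .of_differentiable (differentiable_const _)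

theorem dense_range_contGraph (h : IsRep α) (z : ℂ) :
    Dense {b : E | ∃ a, (a, b) ∈ contGraph α z} := fun b =>
  mem_closure_of_tendsto (h.tendsto_smear b) <| (eventually_gt_atTop 0).mono fun _ hr =>
    ⟨_, by simpa using h.smear_mem_contGraph hr b (-z) z⟩

/-- The Gaussian means along a representation are entire, so they can be continued without any
assumption on the vector; this turns membership in the graph into a family of closed conditions. -/
theorem mem_contGraph_iff_forall_smear_eq (h : IsRep α) :
    (a, b) ∈ contGraph α z ↔
      ∀ r : ℝ, 0 < r → smear r (fun t => α t a) z = smear r (fun t => α t b) 0 := by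
  refine ⟨fun hab r hr => ?_, fun hsmear => ?_⟩
  · obtain ⟨f, M, hf, hM, hfα, -, hfz⟩ := h.exists_isStripAnalytic_of_mem_contGraph hab
    simpa only [hfα, hfz] using hf.smear_eq_smear_shift hr hM
  · obtain ⟨f, hf, -, hfα, hfz⟩ := exists_isStripAnalytic_of_smear_eq (h.continuous a)
      (h.continuous b) (fun t => (h.norm_apply_le t a).trans (le_max_left _ _))
      (fun t => (h.norm_apply_le t b).trans (le_max_right _ _)) fun r hr x => by
        rw [h.smear_add hr, hsmear r hr, ← h.smear_add hr, zero_add]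
    refine mem_contGraph_iff_exists_isStripAnalytic.2 ⟨f, hf, hfα, ?_⟩
    simpa [h.zero_apply] using hfz 0

omit [CompleteSpace E] in
theorem continuous_smear_apply (h : IsRep α) (hr : 0 < r) (u : ℂ) :
    Continuous fun x => smear r (fun t => α t x) u :=
  (smearCLM (M := 1) hr h.continuous (by simpa using h.norm_apply_le) u).continuous

theorem isClosed_contGraph (h : IsRep α) (z : ℂ) : IsClosed (contGraph α z : Set (E × E)) := by
  have h_eq : (contGraph α z : Set (E × E)) = ⋂ (r : ℝ) (_ : 0 < r),
      {p | smear r (fun t => α t p.1) z = smear r (fun t => α t p.2) 0} := by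
    ext ⟨a, b⟩
    simp only [SetLike.mem_coe, h.mem_contGraph_iff_forall_smear_eq, mem_iInter, mem_ofPred_eq]
  rw [h_eq]
  exact isClosed_biInter fun r hr =>
    isClosed_eq ((h.continuous_smear_apply hr z).comp continuous_fst)
      ((h.continuous_smear_apply hr 0).comp continuous_snd)

end IsRep

end Rep

/-! ### Products of norm continuations -/

section Product

variable {E : Type*} [NormedAddCommGroup E] [NormedSpace ℂ E] [CompleteSpace E]
  {α β : ℝ → E →L[ℂ] E} {z : ℂ} {x y w : E} {r : ℝ}

theorem IsRep.smear_pair_mem_contGraph (h : IsRep α) (hr : 0 < r) {φ ψ : ℝ → E} {M : ℝ}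
    (hφ : Continuous φ) (hψ : Continuous ψ) (hM : ∀ t, ‖φ t‖ ≤ M) (hM' : ∀ t, ‖ψ t‖ ≤ M)
    (hmem : ∀ t, (φ t, ψ t) ∈ contGraph α z) (u : ℂ) :
    (smear r φ u, smear r ψ u) ∈ contGraph α z := by
  refine h.mem_contGraph_iff_forall_smear_eq.2 fun s hs => ?_
  have h_bound : ∀ t a, ‖α t a‖ ≤ 1 * ‖a‖ := by simpa using h.norm_apply_le
  rw [← smearCLM_apply hs h.continuous h_bound, ← smearCLM_apply hs h.continuous h_bound,
    map_smear _ hr hφ hM, map_smear _ hr hψ hM']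
  simp only [smearCLM_apply, h.mem_contGraph_iff_forall_smear_eq.1 (hmem _) s hs]

variable (hα : IsRep α) (hβ : IsRep β) (hcomm : ∀ s t x, α s (β t x) = β t (α s x))

include hα hβ hcomm

theorem smear_mem_contGraph_comp (hxw : (x, w) ∈ contGraph β z) (hwy : (w, y) ∈ contGraph α z)
    (hr : 0 < r) : (smear r (fun t => α t x) 0, smear r (fun t => α t y) 0) ∈
      contGraph (fun t => α t ∘L β t) z := by
  obtain ⟨g, M, hg, hM, hgβ, hgz, -⟩ := hβ.exists_isStripAnalytic_of_mem_contGraph hxw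
  refine mem_contGraph_iff_exists_isStripAnalytic.2
    ⟨fun u => smear r (fun t => α t (g u)) u, hg.smear_clm_apply (p := id) hM hr hα.continuous
      (M := 1) (by simpa using hα.norm_apply_le) differentiable_id, fun t => ?_, ?_⟩
  · simp only [hgβ, ContinuousLinearMap.comp_apply]
    rw [hα.map_smear_of_comm hr fun s x => (hcomm s t x).symm, ← hα.smear_add hr, zero_add]
  · simpa only [hgz] using hα.mem_contGraph_iff_forall_smear_eq.1 hwy r hr

theorem mem_contGraph_comp (hxw : (x, w) ∈ contGraph β z) (hwy : (w, y) ∈ contGraph α z) :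
    (x, y) ∈ contGraph (fun t => α t ∘L β t) z :=
  ((hα.comp hβ hcomm).isClosed_contGraph z).mem_of_tendsto
    ((hα.tendsto_smear x).prodMk_nhds (hα.tendsto_smear y)) <|
    (eventually_gt_atTop 0).mono fun _ hr => smear_mem_contGraph_comp hα hβ hcomm hxw hwy hr

theorem smear_mem_contGraph_left (hxy : (x, y) ∈ contGraph (fun t => α t ∘L β t) z) (hr : 0 < r)
    (v : ℂ) : (smear r (fun t => β t x) v, smear r (fun t => β t y) (v - z)) ∈ contGraph α z := by
  obtain ⟨f, M, hf, hM, hfγ, hfz, -⟩ :=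
    (hα.comp hβ hcomm).exists_isStripAnalytic_of_mem_contGraph hxy
  refine mem_contGraph_iff_exists_isStripAnalytic.2
    ⟨fun u => smear r (fun t => β t (f u)) (v - u),
      hf.smear_clm_apply hM hr hβ.continuous (M := 1) (by simpa using hβ.norm_apply_le)
        (differentiable_id.const_sub v), fun t => ?_, by simp only [hfz]⟩
  have h_comm : ∀ s x, (α t ∘L β t) (β s x) = β s ((α t ∘L β t) x) := fun s x => by
    simp only [ContinuousLinearMap.comp_apply, ← hcomm, ← hβ.add_apply, add_comm]
  simp only [hfγ]
  rw [← hβ.map_smear_of_comm hr h_comm, ContinuousLinearMap.comp_apply, ← hβ.smear_add hr,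
    sub_add_cancel]

theorem smear_mem_pcomp_graph (hxy : (x, y) ∈ contGraph (fun t => α t ∘L β t) z) (hr : 0 < r) :
    (smear r (fun t => β t x) 0, smear r (fun t => β t y) 0) ∈
      ((pcomp (cont α z) (cont β z)).graph ⊓ (pcomp (cont β z) (cont α z)).graph :
        Submodule ℂ (E × E)) := by
  have h_left := smear_mem_contGraph_left hα hβ hcomm hxy hr
  simp only [Submodule.mem_inf, mem_pcomp_graph, cont_graph]
  exact ⟨⟨_, by simpa using hβ.smear_mem_contGraph hr x 0 z, by simpa using h_left z⟩,
    ⟨_, h_left 0, by simpa using hβ.smear_mem_contGraph hr y (-z) z⟩⟩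

theorem contGraph_comp_subset_closure :
    (contGraph (fun t => α t ∘L β t) z : Set (E × E)) ⊆
      closure ((pcomp (cont α z) (cont β z)).graph ⊓ (pcomp (cont β z) (cont α z)).graph :
        Submodule ℂ (E × E)) :=
  fun ⟨x, y⟩ hxy => mem_closure_of_tendsto ((hβ.tendsto_smear x).prodMk_nhds (hβ.tendsto_smear y))
    ((eventually_gt_atTop 0).mono fun _ hr =>
      smear_mem_pcomp_graph hα hβ hcomm hxy hr)

end Product

/-! ### Operators intertwining norm continuations -/

section Intertwines

variable {E F : Type*} [NormedAddCommGroup E] [NormedSpace ℂ E] [NormedAddCommGroup F]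
  [NormedSpace ℂ F]

/-- The orbit of an operator `c` under conjugation by two representations. For a semi-multiplicative
representation, its strict extension moves the left and right actions of a multiplier along such
orbits. -/
def conj (ρ : ℝ → E →L[ℂ] E) (γ : ℝ → F →L[ℂ] F) (c : E →L[ℂ] F) (t : ℝ) : E →L[ℂ] F :=
  γ t ∘L c ∘L ρ (-t)

/-- `Intertwines ρ γ z a b` says that `γ_z a` extends `b ρ_z`. For a semi-multiplicative `γ` with
companion `ρ`, multipliers acting as `a` and `b` belong to the graph of the strict continuation of
`γ` at `z` when this holds on both sides. -/
def Intertwines (ρ : ℝ → E →L[ℂ] E) (γ : ℝ → F →L[ℂ] F) (z : ℂ) (a b : E →L[ℂ] F) : Prop :=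
  ∀ x y, (x, y) ∈ contGraph ρ z → (a x, b y) ∈ contGraph γ z

section Conj

variable {ρ : ℝ → E →L[ℂ] E} {γ : ℝ → F →L[ℂ] F} (hρ : IsRep ρ) (hγ : IsRep γ)

include hρ hγ

theorem continuous_conj_apply (c : E →L[ℂ] F) (x : E) : Continuous fun t => conj ρ γ c t x :=
  hγ.continuous_comp (c.continuous.comp ((hρ.continuous x).comp continuous_neg))

theorem norm_conj_apply_le (c : E →L[ℂ] F) (t : ℝ) (x : E) : ‖conj ρ γ c t x‖ ≤ ‖c‖ * ‖x‖ :=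
  (hγ.norm_apply_le _ _).trans (c.le_opNorm_of_le (hρ.norm_apply_le _ _))

theorem conj_add_apply (c : E →L[ℂ] F) (s t : ℝ) (x : E) :
    conj ρ γ c (s + t) (ρ t x) = γ t (conj ρ γ c s x) := by
  simp only [conj, ContinuousLinearMap.comp_apply]
  rw [← hρ.add_apply, ← hγ.add_apply, add_comm s t, neg_add_rev, neg_add_cancel_right]

variable [CompleteSpace E] [CompleteSpace F] {z : ℂ} {a b : E →L[ℂ] F} {x y : E} {r : ℝ}

theorem smear_conj_mem_contGraph (c : E →L[ℂ] F) (hxy : (x, y) ∈ contGraph ρ z) (hr : 0 < r)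
    (v : ℂ) : (smear r (fun t => conj ρ γ c t x) v, smear r (fun t => conj ρ γ c t y) (v + z)) ∈
      contGraph γ z := by
  obtain ⟨g, M, hg, hM, hgρ, hgz, -⟩ := hρ.exists_isStripAnalytic_of_mem_contGraph hxy
  refine mem_contGraph_iff_exists_isStripAnalytic.2
    ⟨fun u => smear r (fun t => conj ρ γ c t (g u)) (v + u),
      hg.smear_clm_apply hM hr (continuous_conj_apply hρ hγ c) (norm_conj_apply_le hρ hγ c)
        (differentiable_id.const_add v), fun t => ?_, by simp only [hgz]⟩
  simp only [hgρ, smear_add_ofReal, conj_add_apply hρ hγ]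
  exact (map_smear (γ t) hr (continuous_conj_apply hρ hγ c x)
    (norm_conj_apply_le hρ hγ c · x) v).symm

theorem Intertwines.conj_mem_contGraph (h : Intertwines ρ γ z a b) (hxy : (x, y) ∈ contGraph ρ z)
    (t : ℝ) : (conj ρ γ a t x, conj ρ γ b t y) ∈ contGraph γ z :=
  hγ.apply_mem_contGraph t (h _ _ (hρ.apply_mem_contGraph (-t) hxy))

theorem Intertwines.smear_conj_eq_of_mem (h : Intertwines ρ γ z a b)
    (hxy : (x, y) ∈ contGraph ρ z) (hr : 0 < r) (v : ℂ) :
    smear r (fun t => conj ρ γ a t y) (v + z) = smear r (fun t => conj ρ γ b t y) v := by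
  refine eq_of_mem_contGraph (smear_conj_mem_contGraph hρ hγ a hxy hr v) ?_
  exact hγ.smear_pair_mem_contGraph hr (continuous_conj_apply hρ hγ a x)
    (continuous_conj_apply hρ hγ b y)
    (fun t => (norm_conj_apply_le hρ hγ a t x).trans (le_max_left _ _))
    (fun t => (norm_conj_apply_le hρ hγ b t y).trans (le_max_right _ _))
    (h.conj_mem_contGraph hρ hγ hxy) v

theorem Intertwines.smear_conj_eq (h : Intertwines ρ γ z a b) (hr : 0 < r) (v : ℂ) (x : E) :
    smear r (fun t => conj ρ γ a t x) (v + z) = smear r (fun t => conj ρ γ b t x) v := by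
  let L (c : E →L[ℂ] F) (u : ℂ) : E →L[ℂ] F :=
    smearCLM hr (continuous_conj_apply hρ hγ c) (norm_conj_apply_le hρ hγ c) u
  have h_eq : ∀ y ∈ {y | ∃ x, (x, y) ∈ contGraph ρ z}, L a (v + z) y = L b v y :=
    fun y ⟨_, hxy⟩ => h.smear_conj_eq_of_mem hρ hγ hxy hr v
  exact congrFun ((L a (v + z)).continuous.ext_on (hρ.dense_range_contGraph z) (L b v).continuous
    h_eq) x

theorem Intertwines.exists_isStripAnalytic (h : Intertwines ρ γ z a b) (x : E) :
    ∃ f : ℂ → F, IsStripAnalytic f z ∧ (∀ u ∈ strip z, ‖f u‖ ≤ max ‖a‖ ‖b‖ * ‖x‖) ∧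
      (∀ t : ℝ, f t = conj ρ γ a t x) ∧ f z = b x := by
  obtain ⟨f, hf, hM, hfa, hfb⟩ := exists_isStripAnalytic_of_smear_eq (z := z)
    (M := max ‖a‖ ‖b‖ * ‖x‖) (continuous_conj_apply hρ hγ a x) (continuous_conj_apply hρ hγ b x)
    (fun t => (norm_conj_apply_le hρ hγ a t x).trans (by gcongr; exact le_max_left _ _))
    (fun t => (norm_conj_apply_le hρ hγ b t x).trans (by gcongr; exact le_max_right _ _))
    fun r hr t => by rw [add_comm z, h.smear_conj_eq hρ hγ hr]
  refine ⟨f, hf, hM, hfa, ?_⟩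
  simpa [conj, hρ.zero_apply, hγ.zero_apply] using hfb 0

end Conj

variable [CompleteSpace E] [CompleteSpace F]

theorem Intertwines.comp {ρ σ : ℝ → E →L[ℂ] E} {α β : ℝ → F →L[ℂ] F} {z : ℂ} {a w y : E →L[ℂ] F}
    (hρ : IsRep ρ) (hσ : IsRep σ) (hρσ : ∀ s t x, ρ s (σ t x) = σ t (ρ s x))
    (hα : IsRep α) (hβ : IsRep β) (hαβ : ∀ s t x, α s (β t x) = β t (α s x))
    (hα_int : Intertwines ρ α z w y) (hβ_int : Intertwines σ β z a w) :
    Intertwines (fun t => ρ t ∘L σ t) (fun t => α t ∘L β t) z a y := by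
  intro p q hpq
  have h_closed : IsClosed {pq : E × E | (a pq.1, y pq.2) ∈ contGraph (fun t => α t ∘L β t) z} :=
    ((hα.comp hβ hαβ).isClosed_contGraph z).preimage
      ((a.continuous.comp continuous_fst).prodMk (y.continuous.comp continuous_snd))
  refine closure_minimal ?_ h_closed (contGraph_comp_subset_closure hρ hσ hρσ hpq)
  rintro ⟨p, q⟩ hpq
  obtain ⟨v, hpv, hvq⟩ := mem_pcomp_graph.1 (Submodule.mem_inf.1 hpq).1
  rw [cont_graph] at hpv hvq
  exact mem_contGraph_comp hα hβ hαβ (hβ_int p v hpv) (hα_int v q hvq)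

end Intertwines

/-! ### Analyticity in the strong operator topology -/

section StrongAnalyticity

variable {E F V : Type*} [NormedAddCommGroup E] [NormedSpace ℂ E] [NormedAddCommGroup F]
  [NormedSpace ℂ F] [NormedAddCommGroup V] [NormedSpace ℂ V] {L : V →ₗᵢ[ℂ] E →L[ℂ] F}
  {f : ℂ → V} {U : Set ℂ} {M : ℝ}

theorem norm_sub_le_of_differentiableOn {g : ℂ → F} {c : ℂ} {R : ℝ} (hR : 0 < R)
    (hg : DifferentiableOn ℂ g (closedBall c (2 * R))) (hM : ∀ u ∈ closedBall c (2 * R), ‖g u‖ ≤ M)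
    {u v : ℂ} (hu : u ∈ ball c R) (hv : v ∈ ball c R) : ‖g v - g u‖ ≤ M / R * ‖v - u‖ := by
  have h_sub : ∀ w ∈ ball c R, closedBall w R ⊆ closedBall c (2 * R) := fun w hw =>
    closedBall_subset_closedBall' (by linarith [mem_ball.1 hw])
  have h_nhds : ∀ w ∈ ball c R, closedBall c (2 * R) ∈ 𝓝 w := fun w hw =>
    mem_of_superset (closedBall_mem_nhds w hR) (h_sub w hw)
  refine (convex_ball c R).norm_image_sub_le_of_norm_deriv_le
    (fun w hw => hg.differentiableAt (h_nhds w hw)) (fun w hw => ?_) hu hv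
  refine Complex.norm_deriv_le_of_forall_mem_sphere_norm_le hR
    (DifferentiableOn.diffContOnCl (hg.mono ?_))
    fun w' hw' => hM w' (h_sub w hw (sphere_subset_closedBall hw'))
  rw [closure_ball w hR.ne']
  exact h_sub w hw

theorem continuousOn_of_forall_differentiableOn_apply (hU : IsOpen U) (hM : ∀ u ∈ U, ‖f u‖ ≤ M)
    (hf : ∀ x, DifferentiableOn ℂ (fun u => L (f u) x) U) : ContinuousOn f U := by
  intro c hc
  have hM₀ : 0 ≤ M := (norm_nonneg _).trans (hM c hc)
  obtain ⟨R, hR, hRU⟩ := nhds_basis_closedBall.mem_iff.1 (hU.mem_nhds hc)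
  have h_lip : LipschitzOnWith (Real.toNNReal (M / (R / 2))) f (ball c (R / 2)) := by
    refine LipschitzOnWith.of_dist_le_mul fun v hv u hu => ?_
    rw [dist_eq_norm, dist_eq_norm, Real.coe_toNNReal _ (by positivity), ← L.norm_map]
    refine ContinuousLinearMap.opNorm_le_bound _ (by positivity) fun x => ?_
    rw [map_sub, sub_apply, mul_right_comm, div_mul_eq_mul_div]
    have h_two : closedBall c (2 * (R / 2)) ⊆ U := by rwa [mul_div_cancel₀ R two_ne_zero]
    refine norm_sub_le_of_differentiableOn (by positivity) ((hf x).mono h_two) (fun w hw => ?_)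
      hu hv
    exact ((L (f w)).le_opNorm x).trans (by rw [L.norm_map]; gcongr; exact hM w (h_two hw))
  exact (h_lip.continuousOn.continuousAt (ball_mem_nhds c (by positivity))).continuousWithinAt

variable [CompleteSpace V] [CompleteSpace F]

theorem cauchy_formula_of_forall_differentiableOn_apply {c w : ℂ} {R : ℝ}
    (hc : ContinuousOn f (closedBall c R))
    (hf : ∀ x, DifferentiableOn ℂ (fun u => L (f u) x) (closedBall c R)) (hw : w ∈ ball c R) :
    (2 * Real.pi * Complex.I : ℂ)⁻¹ • ∮ ζ in C(c, R), (ζ - w)⁻¹ • f ζ = f w := by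
  have hR : 0 ≤ R := (pos_of_mem_ball hw).le
  have h_inv : ContinuousOn (fun ζ => (ζ - w)⁻¹) (sphere c R) := by
    refine ContinuousOn.inv₀ (by fun_prop) fun ζ hζ => sub_ne_zero.2 ?_
    rintro rfl
    exact (mem_ball.1 hw).ne (mem_sphere.1 hζ)
  have h_int : CircleIntegrable (fun ζ => (ζ - w)⁻¹ • f ζ) c R :=
    (h_inv.smul (hc.mono sphere_subset_closedBall)).circleIntegrable hR
  refine L.injective (ContinuousLinearMap.ext fun x => ?_)
  let ev : V →L[ℂ] F := L.toContinuousLinearMap.flip x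
  change ev _ = ev (f w)
  have h_cauchy :=
    ((hf x).diffContOnCl_ball subset_rfl).two_pi_i_inv_smul_circleIntegral_sub_inv_smul hw
  rw [map_smul, circleIntegral, ← ev.intervalIntegral_comp_comm h_int.out]
  simp only [map_smul]
  exact h_cauchy

theorem differentiableOn_of_forall_differentiableOn_apply (hU : IsOpen U)
    (hM : ∀ u ∈ U, ‖f u‖ ≤ M) (hf : ∀ x, DifferentiableOn ℂ (fun u => L (f u) x) U) :
    DifferentiableOn ℂ f U := by
  intro c hc
  obtain ⟨R, hR, hRU⟩ := nhds_basis_closedBall.mem_iff.1 (hU.mem_nhds hc)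
  have h_cont : ContinuousOn f (closedBall c R) :=
    (continuousOn_of_forall_differentiableOn_apply hU hM hf).mono hRU
  have h_series := hasFPowerSeriesOn_cauchy_integral (f := f) (c := c) (R := ⟨R, hR.le⟩)
    ((h_cont.mono sphere_subset_closedBall).circleIntegrable hR.le) hR
  refine (h_series.analyticAt.differentiableAt.congr_of_eventuallyEq ?_).differentiableWithinAt
  filter_upwards [ball_mem_nhds c hR] with w hw
  exact (cauchy_formula_of_forall_differentiableOn_apply h_cont (fun x => (hf x).mono hRU) hw).symm

end StrongAnalyticity

/-! ### Multipliers -/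

section Multiplier

variable {A : Type*} [NonUnitalCStarAlgebra A]

theorem eq_of_forall_mul_right {x y : A} (h : ∀ c : A, x * c = y * c) : x = y := by
  have h_sq : (x - y) * star (x - y) = 0 := by rw [sub_mul, h, sub_self]
  exact sub_eq_zero.1 ((CStarRing.mul_star_self_eq_zero_iff _).1 h_sq)

/-- Multipliers as operators by left multiplication; the norm of `𝓜(ℂ, A)` is the operator norm. -/
def fstₗᵢ (A : Type*) [NonUnitalCStarAlgebra A] : 𝓜(ℂ, A) →ₗᵢ[ℂ] A →L[ℂ] A where
  toFun x := x.fst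
  map_add' _ _ := rfl
  map_smul' _ _ := rfl
  norm_map' x := DoubleCentralizer.norm_fst x

/-- Multipliers as operators by right multiplication. -/
def sndₗᵢ (A : Type*) [NonUnitalCStarAlgebra A] : 𝓜(ℂ, A) →ₗᵢ[ℂ] A →L[ℂ] A where
  toFun x := x.snd
  map_add' _ _ := rfl
  map_smul' _ _ := rfl
  norm_map' x := DoubleCentralizer.norm_snd x

theorem eq_of_fst_eq {x y : 𝓜(ℂ, A)} (h : ∀ d, x.fst d = y.fst d) : x = y :=
  (fstₗᵢ A).injective (ContinuousLinearMap.ext h)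

/-- The C⋆-identity bounds `r` by `l`, and cancellation makes both maps linear. -/
theorem exists_doubleCentralizer {l r : A → A} {M : ℝ} (hM : 0 ≤ M) (h : ∀ a b, r a * b = a * l b)
    (hl : ∀ d, ‖l d‖ ≤ M * ‖d‖) :
    ∃ x : 𝓜(ℂ, A), (∀ d, x.fst d = l d) ∧ (∀ d, x.snd d = r d) ∧ ‖x‖ ≤ M := by
  have hr : ∀ d, ‖r d‖ ≤ M * ‖d‖ := fun d => by
    rw [← ContinuousLinearMap.opNorm_mul_apply ℂ A (r d)]
    refine ContinuousLinearMap.opNorm_le_bound _ (by positivity) fun b => ?_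
    calc ‖r d * b‖ = ‖d * l b‖ := by rw [h]
      _ ≤ ‖d‖ * (M * ‖b‖) := (norm_mul_le _ _).trans (by gcongr; exact hl b)
      _ = M * ‖d‖ * ‖b‖ := by ring
  let L : A →L[ℂ] A := LinearMap.mkContinuous
    { toFun := l
      map_add' := fun b c => eq_of_forall_mul_left fun a => by simp only [mul_add, ← h]
      map_smul' := fun k b => eq_of_forall_mul_left fun a => by
        simp only [RingHom.id_apply, mul_smul_comm, ← h] } M hl
  let R : A →L[ℂ] A := LinearMap.mkContinuous
    { toFun := r
      map_add' := fun b c => eq_of_forall_mul_right fun a => by simp only [add_mul, h]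
      map_smul' := fun k b => eq_of_forall_mul_right fun a => by
        simp only [RingHom.id_apply, smul_mul_assoc, h] } M hr
  let x : 𝓜(ℂ, A) := { fst := L, snd := R, central := h }
  refine ⟨x, fun _ => rfl, fun _ => rfl, ?_⟩
  rw [← DoubleCentralizer.norm_fst]
  exact L.opNorm_le_bound hM hl

theorem continuous_strict_fst (d : A) :
    @Continuous _ _ (strictTopology A) _ fun x : 𝓜(ℂ, A) => x.fst d := by
  let _ := strictTopology A
  exact continuousOn_univ.1 ((strictContinuousOn_iff (f := id)).1 continuousOn_id d).1

theorem continuous_strict_snd (d : A) :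
    @Continuous _ _ (strictTopology A) _ fun x : 𝓜(ℂ, A) => x.snd d := by
  let _ := strictTopology A
  exact continuousOn_univ.1 ((strictContinuousOn_iff (f := id)).1 continuousOn_id d).2

end Multiplier

/-! ### Semi-multiplicative representations -/

section SemiMultiplicative

variable {A : Type*} [NonUnitalCStarAlgebra A] {γ γl γr : ℝ → A →L[ℂ] A}

/-- A semi-multiplicative representation `γ` with named companions `γl` and `γr`, through which it
acts on multipliers; `IsSemiMultiplicative` only asserts that companions exist. -/
structure IsSemiMultiplicativeWith (γ γl γr : ℝ → A →L[ℂ] A) : Prop where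
  rep : IsRep γ
  left : IsRep γl
  right : IsRep γr
  left_mul : ∀ t b a, γl t b * γ t a = γ t (b * a)
  mul_right : ∀ t a b, γ t a * γr t b = γ t (a * b)

theorem IsSemiMultiplicative.exists_with (h : IsSemiMultiplicative γ) (hγ : IsRep γ) :
    ∃ γl γr, IsSemiMultiplicativeWith γ γl γr :=
  let ⟨γl, γr, hl, hr, h_mul⟩ := h
  ⟨γl, γr, hγ, hl, hr, fun t b a => (h_mul t a b).1, fun t a b => (h_mul t a b).2⟩

namespace IsSemiMultiplicativeWith

theorem isSemiMultiplicative (h : IsSemiMultiplicativeWith γ γl γr) : IsSemiMultiplicative γ :=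
  ⟨γl, γr, h.left, h.right, fun t a b => ⟨h.left_mul t b a, h.mul_right t a b⟩⟩

theorem right_apply_mul (h : IsSemiMultiplicativeWith γ γl γr) (t : ℝ) (a b : A) :
    γr t (a * b) = γr t a * γr t b := by
  refine eq_of_forall_mul_left fun c => ?_
  rw [← h.rep.apply_neg t c, h.mul_right, ← mul_assoc, ← mul_assoc, h.mul_right, h.mul_right]

theorem apply_mul (h : IsSemiMultiplicativeWith γ γl γr) (t : ℝ) (a d : A) :
    γ t a * d = γ t (a * γr (-t) d) := by
  rw [← h.mul_right, h.right.apply_neg]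

theorem mul_apply (h : IsSemiMultiplicativeWith γ γl γr) (t : ℝ) (d a : A) :
    d * γ t a = γ t (γl (-t) d * a) := by
  rw [← h.left_mul, h.left.apply_neg]

end IsSemiMultiplicativeWith

theorem isStrictExtension_of_fst_snd_eq {ρ : A →L[ℂ] A} {θ : 𝓜(ℂ, A) →ₗ[ℂ] 𝓜(ℂ, A)}
    {l r : A → A} (hρ : ∀ a d, ρ a * d = ρ (a * r d))
    (h_fst : ∀ x d, (θ x).fst d = ρ (x.fst (r d)))
    (h_snd : ∀ x d, (θ x).snd d = ρ (x.snd (l d))) : IsStrictExtension ρ θ where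
  extends_apply a := eq_of_fst_eq fun d => (h_fst a d).trans (hρ a d).symm
  continuousOn s _ := by
    let _ := strictTopology A
    refine (strictContinuousOn_iff (f := θ)).2 fun d => ?_
    simp only [h_fst, h_snd]
    exact ⟨(ρ.continuous.comp (continuous_strict_fst (r d))).continuousOn,
      (ρ.continuous.comp (continuous_strict_snd (l d))).continuousOn⟩

namespace IsSemiMultiplicativeWith

theorem strictExtension_fst_snd (h : IsSemiMultiplicativeWith γ γl γr) (t : ℝ) (x : 𝓜(ℂ, A)) :
    (strictExtension (γ t) x).fst = conj γr γ x.fst t ∧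
      (strictExtension (γ t) x).snd = conj γl γ x.snd t := by
  let θ : 𝓜(ℂ, A) →ₗ[ℂ] 𝓜(ℂ, A) :=
    { toFun := fun x =>
        { fst := conj γr γ x.fst t
          snd := conj γl γ x.snd t
          central := fun a b => by
            simp only [conj, ContinuousLinearMap.comp_apply]
            rw [h.apply_mul, h.mul_apply, x.central] }
      map_add' := fun x y => eq_of_fst_eq fun d => map_add (γ t) (x.fst _) (y.fst _)
      map_smul' := fun k x => eq_of_fst_eq fun d => map_smul (γ t) k (x.fst _) }
  have hθ : IsStrictExtension (γ t) θ :=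
    isStrictExtension_of_fst_snd_eq (h.apply_mul t) (fun _ _ => rfl) fun _ _ => rfl
  rw [← (strictExtension_spec h.isSemiMultiplicative t).2 θ hθ]
  exact ⟨rfl, rfl⟩

variable {α αl αr β βl βr : ℝ → A →L[ℂ] A}

theorem right_comm (hα : IsSemiMultiplicativeWith α αl αr)
    (hβ : IsSemiMultiplicativeWith β βl βr) (hcomm : ∀ s t x, α s (β t x) = β t (α s x))
    (s t : ℝ) (x : A) : αr s (βr t x) = βr t (αr s x) := by
  refine eq_of_forall_mul_left fun c => ?_
  obtain ⟨c, rfl⟩ : ∃ d, α s (β t d) = c :=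
    ⟨β (-t) (α (-s) c), by rw [hβ.rep.apply_neg, hα.rep.apply_neg]⟩
  rw [hα.mul_right, hβ.mul_right, hcomm, hcomm, hβ.mul_right, hα.mul_right]

theorem left_comm (hα : IsSemiMultiplicativeWith α αl αr)
    (hβ : IsSemiMultiplicativeWith β βl βr) (hcomm : ∀ s t x, α s (β t x) = β t (α s x))
    (s t : ℝ) (x : A) : αl s (βl t x) = βl t (αl s x) := by
  refine eq_of_forall_mul_right fun c => ?_
  obtain ⟨c, rfl⟩ : ∃ d, α s (β t d) = c :=
    ⟨β (-t) (α (-s) c), by rw [hβ.rep.apply_neg, hα.rep.apply_neg]⟩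
  rw [hα.left_mul, hβ.left_mul, hcomm, hcomm, hβ.left_mul, hα.left_mul]

theorem comp (hα : IsSemiMultiplicativeWith α αl αr) (hβ : IsSemiMultiplicativeWith β βl βr)
    (hcomm : ∀ s t x, α s (β t x) = β t (α s x)) :
    IsSemiMultiplicativeWith (fun t => α t ∘L β t) (fun t => αl t ∘L βl t)
      (fun t => αr t ∘L βr t) where
  rep := hα.rep.comp hβ.rep hcomm
  left := hα.left.comp hβ.left (hα.left_comm hβ hcomm)
  right := hα.right.comp hβ.right (hα.right_comm hβ hcomm)
  left_mul t b a := by simp only [ContinuousLinearMap.comp_apply, hα.left_mul, hβ.left_mul]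
  mul_right t a b := by simp only [ContinuousLinearMap.comp_apply, hα.mul_right, hβ.mul_right]

end IsSemiMultiplicativeWith

end SemiMultiplicative

/-! ### Strict continuations -/

theorem intertwines_of_continuousOn_apply {E F : Type*} [NormedAddCommGroup E] [NormedSpace ℂ E]
    [CompleteSpace E] [NormedAddCommGroup F] [NormedSpace ℂ F] [CompleteSpace F]
    {ρ : ℝ → E →L[ℂ] E} {γ : ℝ → F →L[ℂ] F} {z : ℂ} {T : ℂ → E →L[ℂ] F} {a : E →L[ℂ] F}
    (hρ : IsRep ρ) (hT : ∀ x, ContinuousOn (fun u => T u x) (strip z))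
    (hT' : DifferentiableOn ℂ T (interior (strip z))) (ha : ∀ t : ℝ, T t = conj ρ γ a t) :
    Intertwines ρ γ z a (T z) := by
  intro x y hxy
  obtain ⟨g, hg, hgρ, hgz⟩ := mem_contGraph_iff_exists_isStripAnalytic.1 hxy
  refine mem_contGraph_iff_exists_isStripAnalytic.2
    ⟨fun u => T u (g u),
      ⟨continuousOn_clm_apply_of_forall (isClosed_strip z) hT hg.continuousOn,
        hT'.clm_apply hg.differentiableOn⟩, fun t => ?_, by simp only [hgz]⟩
  simp only [ha, hgρ, conj, ContinuousLinearMap.comp_apply, hρ.neg_apply]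

theorem map₂_mem_contGraph {E F G : Type*} [NormedAddCommGroup E] [NormedSpace ℂ E]
    [CompleteSpace E] [NormedAddCommGroup F] [NormedSpace ℂ F] [CompleteSpace F]
    [NormedAddCommGroup G] [NormedSpace ℂ G] [CompleteSpace G] {α : ℝ → E →L[ℂ] E}
    {β : ℝ → F →L[ℂ] F} {γ : ℝ → G →L[ℂ] G} {z : ℂ} {x y : E} {p q : F}
    (B : E →L[ℂ] F →L[ℂ] G) (hB : ∀ t x p, B (α t x) (β t p) = γ t (B x p))
    (hxy : (x, y) ∈ contGraph α z) (hpq : (p, q) ∈ contGraph β z) :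
    (B x p, B y q) ∈ contGraph γ z := by
  rw [mem_contGraph_iff_exists_isStripAnalytic] at hxy hpq ⊢
  obtain ⟨f, hf, hfα, rfl⟩ := hxy
  obtain ⟨g, hg, hgβ, rfl⟩ := hpq
  have hBf := hf.clm_comp B
  exact ⟨fun u => B (f u) (g u), ⟨hBf.continuousOn.clm_apply hg.continuousOn,
    hBf.differentiableOn.clm_apply hg.differentiableOn⟩,
    fun t => by simp only [hfα, hgβ, hB], rfl⟩

theorem isClosed_setOf_intertwines {X E F : Type*} [TopologicalSpace X] [NormedAddCommGroup E]
    [NormedSpace ℂ E] [NormedAddCommGroup F] [NormedSpace ℂ F] [CompleteSpace F]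
    {ρ : ℝ → E →L[ℂ] E} {γ : ℝ → F →L[ℂ] F} {z : ℂ} {a b : X → E →L[ℂ] F} (hγ : IsRep γ)
    (ha : ∀ x, Continuous fun p => a p x) (hb : ∀ y, Continuous fun p => b p y) :
    IsClosed {p | Intertwines ρ γ z (a p) (b p)} := by
  simp only [Intertwines, ofPred_forall]
  exact isClosed_iInter fun x => isClosed_iInter fun y => isClosed_iInter fun _ =>
    (hγ.isClosed_contGraph z).preimage ((ha x).prodMk (hb y))

section StrictContinuation

variable {A : Type*} [NonUnitalCStarAlgebra A] {γ γl γr : ℝ → A →L[ℂ] A} {z : ℂ}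
  {a b : 𝓜(ℂ, A)}

namespace IsSemiMultiplicativeWith

theorem intertwines_of_mem_strictContGraph (h : IsSemiMultiplicativeWith γ γl γr)
    (hab : (a, b) ∈ strictContGraph γ z) :
    Intertwines γr γ z a.fst b.fst ∧ Intertwines γl γ z a.snd b.snd := by
  obtain ⟨f, hf, hf', hfγ, rfl⟩ := hab
  rw [strictContinuousOn_iff] at hf
  exact ⟨intertwines_of_continuousOn_apply h.right (fun d => (hf d).1)
      ((fstₗᵢ A).toContinuousLinearMap.differentiable.comp_differentiableOn hf'.differentiableOn)
      fun t => by rw [hfγ, (h.strictExtension_fst_snd t _).1],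
    intertwines_of_continuousOn_apply h.left (fun d => (hf d).2)
      ((sndₗᵢ A).toContinuousLinearMap.differentiable.comp_differentiableOn hf'.differentiableOn)
      fun t => by rw [hfγ, (h.strictExtension_fst_snd t _).2]⟩

/-- The continuations of `t ↦ γ t (a * γr (-t) d)` and `t ↦ γ t (γl (-t) c * a)` satisfy the
centrality identity on the real axis, hence on the strip, so they define multipliers. -/
theorem exists_multiplier_continuation (h : IsSemiMultiplicativeWith γ γl γr)
    (h_fst : Intertwines γr γ z a.fst b.fst) (h_snd : Intertwines γl γ z a.snd b.snd) :
    ∃ f : ℂ → 𝓜(ℂ, A), (∀ u ∈ strip z, ‖f u‖ ≤ max ‖a.fst‖ ‖b.fst‖) ∧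
      (∀ d, IsStripAnalytic (fun u => (f u).fst d) z) ∧
      (∀ d, IsStripAnalytic (fun u => (f u).snd d) z) ∧
      (∀ t : ℝ, f t = strictExtension (γ t) a) ∧ f z = b := by
  choose F hF hFM hFa hFb using h_fst.exists_isStripAnalytic h.right h.rep
  choose G hG _ hGa _ using h_snd.exists_isStripAnalytic h.left h.rep
  have h_central : ∀ c d, EqOn (fun u => G c u * d) (fun u => c * F d u) (strip z) := fun c d =>
    ((hG c).clm_comp ((ContinuousLinearMap.mul ℂ A).flip d)).eqOn
      ((hF d).clm_comp (ContinuousLinearMap.mul ℂ A c)) fun t => by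
        simp only [ContinuousLinearMap.flip_apply, ContinuousLinearMap.mul_apply', hFa, hGa]
        rw [← (h.strictExtension_fst_snd t a).1, ← (h.strictExtension_fst_snd t a).2,
          DoubleCentralizer.central]
  have h_mult : ∀ u ∈ strip z, ∃ x : 𝓜(ℂ, A), (∀ d, x.fst d = F d u) ∧ (∀ d, x.snd d = G d u) ∧
      ‖x‖ ≤ max ‖a.fst‖ ‖b.fst‖ := fun u hu =>
    exists_doubleCentralizer (le_max_of_le_left (norm_nonneg _))
      (fun c d => h_central c d hu) fun d => hFM d u hu
  choose! f hf_fst hf_snd hfM using h_mult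
  refine ⟨f, hfM, fun d => (hF d).congr fun u hu => hf_fst u hu d,
    fun d => (hG d).congr fun u hu => hf_snd u hu d, fun t => eq_of_fst_eq fun d => ?_,
    eq_of_fst_eq fun d => ?_⟩
  · rw [hf_fst _ (ofReal_mem_strip z t), hFa, (h.strictExtension_fst_snd t a).1]
  · rw [hf_fst _ (self_mem_strip z), hFb]

theorem mem_strictContGraph_iff_intertwines (h : IsSemiMultiplicativeWith γ γl γr) :
    (a, b) ∈ strictContGraph γ z ↔
      Intertwines γr γ z a.fst b.fst ∧ Intertwines γl γ z a.snd b.snd := by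
  refine ⟨h.intertwines_of_mem_strictContGraph, fun ⟨h_fst, h_snd⟩ => ?_⟩
  obtain ⟨f, hM, hf_fst, hf_snd, hfa, hfb⟩ := h.exists_multiplier_continuation h_fst h_snd
  refine ⟨f, strictContinuousOn_iff.2 fun d => ⟨(hf_fst d).continuousOn, (hf_snd d).continuousOn⟩,
    DifferentiableOn.analyticOnNhd ?_ isOpen_interior, hfa, hfb⟩
  exact differentiableOn_of_forall_differentiableOn_apply (L := fstₗᵢ A) isOpen_interior
    (fun u hu => hM u (interior_subset hu)) fun d => (hf_fst d).differentiableOn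

theorem isClosed_strictContGraph (h : IsSemiMultiplicativeWith γ γl γr) (z : ℂ) :
    @IsClosed _ (@instTopologicalSpaceProd _ _ (strictTopology A) (strictTopology A))
      (strictContGraph γ z : Set (𝓜(ℂ, A) × 𝓜(ℂ, A))) := by
  let _ := strictTopology A
  have h_eq : (strictContGraph γ z : Set (𝓜(ℂ, A) × 𝓜(ℂ, A))) =
      {p | Intertwines γr γ z p.1.fst p.2.fst} ∩ {p | Intertwines γl γ z p.1.snd p.2.snd} :=
    Set.ext fun _ => h.mem_strictContGraph_iff_intertwines
  rw [h_eq]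
  exact (isClosed_setOf_intertwines h.rep
      (fun d => (continuous_strict_fst d).comp continuous_fst)
      fun d => (continuous_strict_fst d).comp continuous_snd).inter
    (isClosed_setOf_intertwines h.rep (fun d => (continuous_strict_snd d).comp continuous_fst)
      fun d => (continuous_strict_snd d).comp continuous_snd)

theorem incl_mem_strictContGraph (h : IsSemiMultiplicativeWith γ γl γr) {x y : A}
    (hxy : (x, y) ∈ contGraph γ z) : (incl A x, incl A y) ∈ strictContGraph γ z :=
  h.mem_strictContGraph_iff_intertwines.2
    ⟨fun _ _ hpq => map₂_mem_contGraph (ContinuousLinearMap.mul ℂ A) h.mul_right hxy hpq,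
      fun _ _ hpq => map₂_mem_contGraph (ContinuousLinearMap.mul ℂ A) h.left_mul hpq hxy⟩

variable {α αl αr β βl βr : ℝ → A →L[ℂ] A}

theorem mem_strictContGraph_comp (hα : IsSemiMultiplicativeWith α αl αr)
    (hβ : IsSemiMultiplicativeWith β βl βr) (hcomm : ∀ s t x, α s (β t x) = β t (α s x))
    {w : 𝓜(ℂ, A)} (haw : (a, w) ∈ strictContGraph β z) (hwb : (w, b) ∈ strictContGraph α z) :
    (a, b) ∈ strictContGraph (fun t => α t ∘L β t) z := by
  obtain ⟨haw_fst, haw_snd⟩ := hβ.intertwines_of_mem_strictContGraph haw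
  obtain ⟨hwb_fst, hwb_snd⟩ := hα.intertwines_of_mem_strictContGraph hwb
  exact (hα.comp hβ hcomm).mem_strictContGraph_iff_intertwines.2
    ⟨.comp hα.right hβ.right (hα.right_comm hβ hcomm) hα.rep hβ.rep hcomm hwb_fst haw_fst,
      .comp hα.left hβ.left (hα.left_comm hβ hcomm) hα.rep hβ.rep hcomm hwb_snd haw_snd⟩

theorem pcomp_strictCont_le (hα : IsSemiMultiplicativeWith α αl αr)
    (hβ : IsSemiMultiplicativeWith β βl βr) (hcomm : ∀ s t x, α s (β t x) = β t (α s x)) (z : ℂ) :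
    pcomp (strictCont α z) (strictCont β z) ≤ strictCont (fun t => α t ∘L β t) z := by
  refine LinearPMap.le_of_le_graph ?_
  rintro ⟨a, b⟩ hab
  obtain ⟨w, haw, hwb⟩ := mem_pcomp_graph.1 hab
  rw [strictCont_graph] at haw hwb ⊢
  exact hα.mem_strictContGraph_comp hβ hcomm haw hwb

end IsSemiMultiplicativeWith

end StrictContinuation

/-! ### Smeared approximate units -/

section BoundedFamily

variable {ι E F : Type*} {l : Filter ι} [NormedAddCommGroup E] [NormedSpace ℂ E]
  [NormedAddCommGroup F] [NormedSpace ℂ F] {T : ι → E →L[ℂ] F} {M : ℝ}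

/-- Dominated convergence along a filter that need not be countably generated. -/
theorem tendsto_integral_norm_clm_apply {X : Type*} [MeasurableSpace X] {μ : Measure X}
    (hM : ∀ i, ‖T i‖ ≤ M) (hT : ∀ x, Tendsto (fun i => T i x) l (𝓝 0)) {f : X → E}
    (hf : Integrable f μ) : Tendsto (fun i => ∫ t, ‖T i (f t)‖ ∂μ) l (𝓝 0) := by
  refine Integrable.induction _ ?indicator ?add ?closed ?ae hf
  case indicator =>
    intro c s hs _
    have h_eq : ∀ i t, ‖T i (s.indicator (fun _ => c) t)‖ = s.indicator (fun _ => ‖T i c‖) t :=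
      fun i t => by by_cases ht : t ∈ s <;> simp [ht]
    simpa [h_eq, integral_indicator_const _ hs] using (hT c).norm.const_mul (μ.real s)
  case add =>
    intro f g _ hf hg hf_lim hg_lim
    refine squeeze_zero (fun i => by positivity) (fun i => ?_) (by simpa using hf_lim.add hg_lim)
    have hTf := ((T i).integrable_comp hf).norm
    have hTg := ((T i).integrable_comp hg).norm
    rw [← integral_add hTf hTg]
    refine integral_mono ((T i).integrable_comp (hf.add hg)).norm (hTf.add hTg) fun t => ?_
    simpa using norm_add_le (T i (f t)) (T i (g t))
  case closed =>
    have h_eq : ∀ i (g : X →₁[μ] E), ∫ t, ‖T i (g t)‖ ∂μ = ‖(T i).compLpL 1 μ g‖ := fun i g => by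
      rw [L1.norm_eq_integral_norm]
      exact integral_congr_ae ((ContinuousLinearMap.coeFn_compLpL (T i) g).mono
        fun t ht => by simp only [ht])
    have h_lip : ∀ i, LipschitzWith M.toNNReal fun g : X →₁[μ] E => ‖(T i).compLpL 1 μ g‖ :=
      fun i => by
        have h_norm : ‖(T i).compLpL 1 μ‖₊ ≤ M.toNNReal :=
          NNReal.coe_le_coe.1 ((((T i).norm_compLpL_le).trans (hM i)).trans M.le_coe_toNNReal)
        rw [← one_mul M.toNNReal]
        exact lipschitzWith_one_norm.comp (((T i).compLpL 1 μ).lipschitz.weaken h_norm)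
    simp only [h_eq]
    exact (LipschitzWith.uniformEquicontinuous _ _ h_lip).equicontinuous.isClosed_setOfPred_tendsto
      continuous_const
  case ae =>
    intro f g hfg _ hf_lim
    exact hf_lim.congr fun i => integral_congr_ae (hfg.mono fun t ht => by simp only [ht])

variable {ρ : ℝ → E →L[ℂ] E} {γ : ℝ → F →L[ℂ] F} {r : ℝ}

theorem tendsto_smear_conj (hρ : IsRep ρ) (hγ : IsRep γ) {S : E →L[ℂ] F} (hM : ∀ i, ‖T i‖ ≤ M)
    (hT : ∀ x, Tendsto (fun i => T i x) l (𝓝 (S x))) (hr : 0 < r) (x : E) (u : ℂ) :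
    Tendsto (fun i => smear r (fun t => conj ρ γ (T i) t x) u) l
      (𝓝 (smear r (fun t => conj ρ γ S t x) u)) := by
  have h_int : Integrable fun t : ℝ => gauss r (t - u) • ρ (-t) x :=
    integrable_gauss_smul hr ((hρ.continuous x).comp continuous_neg)
      (fun t => hρ.norm_apply_le (-t) x) u
  have h_lim := tendsto_integral_norm_clm_apply (T := fun i => T i - S) (l := l) (M := M + ‖S‖)
    (fun i => (norm_sub_le _ _).trans (by gcongr; exact hM i))
    (fun y => by simpa using (hT y).sub_const (S y)) h_int
  refine tendsto_iff_norm_sub_tendsto_zero.2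
    (squeeze_zero (fun _ => norm_nonneg _) (fun i => ?_) h_lim)
  rw [← smear_sub hr (continuous_conj_apply hρ hγ (T i) x) (norm_conj_apply_le hρ hγ (T i) · x)
    (continuous_conj_apply hρ hγ S x) (norm_conj_apply_le hρ hγ S · x), smear]
  refine norm_integral_le_of_norm_le ((T i - S).integrable_comp h_int).norm
    (Eventually.of_forall fun t => ?_)
  rw [map_smul, norm_smul, norm_smul]
  gcongr
  simpa [conj] using hγ.norm_apply_le t ((T i - S) (ρ (-t) x))

end BoundedFamily

theorem IsRep.tendsto_smear_apply {ι E : Type*} {l : Filter ι} [NormedAddCommGroup E]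
    [NormedSpace ℂ E] [CompleteSpace E] {ρ : ℝ → E →L[ℂ] E} (hρ : IsRep ρ) {e : ι → E}
    {B : E →L[ℂ] E →L[ℂ] E} (hB : ∀ t x y, ρ t (B x y) = B (ρ t x) (ρ t y)) {M r : ℝ}
    (hM : ∀ i, ‖B (e i)‖ ≤ M) (he : ∀ x, Tendsto (fun i => B (e i) x) l (𝓝 x)) (hr : 0 < r)
    (u : ℂ) (x : E) :
    Tendsto (fun i => B (smear r (fun t => ρ t (e i)) u) x) l (𝓝 x) := by
  have h_conj : ∀ i t, conj ρ ρ (B (e i)) t x = B.flip x (ρ t (e i)) := fun i t => by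
    simp only [conj, ContinuousLinearMap.comp_apply, hB, ContinuousLinearMap.flip_apply]
    rw [hρ.apply_neg]
  have h_id : ∀ t, conj ρ ρ (.id ℂ E) t x = x := fun t => hρ.apply_neg t x
  have h_lim := tendsto_smear_conj hρ hρ (S := .id ℂ E) hM he hr x u
  simp only [h_id, smear_const hr, h_conj] at h_lim
  refine h_lim.congr fun i => ?_
  rw [← map_smear (B.flip x) hr (hρ.continuous (e i)) (hρ.norm_apply_le · (e i)),
    ContinuousLinearMap.flip_apply]

theorem exists_approximateUnit (A : Type*) [NonUnitalCStarAlgebra A] :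
    ∃ l : Filter (closedBall (0 : A) 1), l.NeBot ∧
      (∀ x : A, Tendsto (fun e : closedBall (0 : A) 1 => e * x) l (𝓝 x)) ∧
      ∀ x : A, Tendsto (fun e : closedBall (0 : A) 1 => x * e) l (𝓝 x) := by
  let _ := CStarAlgebra.spectralOrder A
  let _ := CStarAlgebra.spectralOrderedRing A
  have hE := CStarAlgebra.increasingApproximateUnit A
  have := hE.neBot
  refine ⟨comap (↑) (CStarAlgebra.approximateUnit A), comap_coe_neBot_of_le_principal
      (le_principal_iff.2 (hE.eventually_norm.mono fun _ => mem_closedBall_zero_iff.2)),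
    fun x => (hE.tendsto_mul_right x).comp tendsto_comap,
    fun x => (hE.tendsto_mul_left x).comp tendsto_comap⟩

section StrictConvergence

variable {A ι : Type*} [NonUnitalCStarAlgebra A] {l : Filter ι}

theorem tendsto_nhds_strict_iff {f : ι → 𝓜(ℂ, A)} {x : 𝓜(ℂ, A)} :
    Tendsto f l (@nhds _ (strictTopology A) x) ↔
      ∀ d, Tendsto (fun i => (f i).fst d) l (𝓝 (x.fst d)) ∧
        Tendsto (fun i => (f i).snd d) l (𝓝 (x.snd d)) := by
  simp only [nhds_induced, tendsto_comap_iff, nhds_prod_eq, tendsto_prod_iff', Function.comp_def,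
    tendsto_pi_nhds, forall_and]

theorem tendsto_incl_fst_strict {p : ι → A} (hp_mul : ∀ x, Tendsto (fun i => p i * x) l (𝓝 x))
    (mul_hp : ∀ x, Tendsto (fun i => x * p i) l (𝓝 x)) (c : 𝓜(ℂ, A)) :
    Tendsto (fun i => incl A (c.fst (p i))) l (@nhds _ (strictTopology A) c) :=
  tendsto_nhds_strict_iff.2 fun d =>
    ⟨((c.fst.continuous.tendsto d).comp (hp_mul d)).congr fun i => fst_mul c (p i) d,
      (mul_hp (c.snd d)).congr fun i => c.central d (p i)⟩

theorem continuous_strict_incl : @Continuous _ _ _ (strictTopology A) (incl A) := by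
  let _ := strictTopology A
  exact continuous_iff_continuousAt.2 fun x => tendsto_nhds_strict_iff.2 fun d =>
    ⟨(continuous_mul_const d).tendsto x, (continuous_const_mul d).tendsto x⟩

variable {γ γl γr : ℝ → A →L[ℂ] A} {z : ℂ}

theorem IsSemiMultiplicativeWith.tendsto_smear_right_mul (h : IsSemiMultiplicativeWith γ γl γr)
    {e : ι → A} {M : ℝ} (hM : ∀ i, ‖e i‖ ≤ M) (he : ∀ x, Tendsto (fun i => e i * x) l (𝓝 x))
    (u : ℂ) (x : A) : Tendsto (fun i => smear 1 (fun t => γr t (e i)) u * x) l (𝓝 x) :=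
  h.right.tendsto_smear_apply (B := ContinuousLinearMap.mul ℂ A) h.right_apply_mul
    (fun i => ContinuousLinearMap.le_opNorm_of_le _ (hM i)) he one_pos u x

theorem IsSemiMultiplicativeWith.tendsto_mul_smear_right (h : IsSemiMultiplicativeWith γ γl γr)
    {e : ι → A} {M : ℝ} (hM : ∀ i, ‖e i‖ ≤ M) (he : ∀ x, Tendsto (fun i => x * e i) l (𝓝 x))
    (u : ℂ) (x : A) : Tendsto (fun i => x * smear 1 (fun t => γr t (e i)) u) l (𝓝 x) :=
  h.right.tendsto_smear_apply (B := (ContinuousLinearMap.mul ℂ A).flip)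
    (fun t x y => h.right_apply_mul t y x)
    (fun i => ContinuousLinearMap.le_opNorm_of_le _ (hM i)) he one_pos u x

/-- A strict continuation `a ↦ b` is approximated by `a * p ↦ b * q`, where `p ↦ q` is a norm
continuation along `γr` obtained by smearing an approximate unit. -/
theorem IsSemiMultiplicativeWith.strictContGraph_subset_closure
    (h : IsSemiMultiplicativeWith γ γl γr) :
    (strictContGraph γ z : Set (𝓜(ℂ, A) × 𝓜(ℂ, A))) ⊆
      @closure _ (@instTopologicalSpaceProd _ _ (strictTopology A) (strictTopology A))
        (Prod.map (incl A) (incl A) '' contGraph γ z) := by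
  let _ := strictTopology A
  rintro ⟨a, b⟩ hab
  obtain ⟨l, _, h_mul, mul_h⟩ := exists_approximateUnit A
  have h_norm : ∀ e : closedBall (0 : A) 1, ‖(e : A)‖ ≤ 1 := fun e => mem_closedBall_zero_iff.1 e.2
  have h_lim (c : 𝓜(ℂ, A)) (u : ℂ) : Tendsto
      (fun e : closedBall (0 : A) 1 => incl A (c.fst (smear 1 (fun t => γr t e) u))) l (𝓝 c) :=
    tendsto_incl_fst_strict (h.tendsto_smear_right_mul h_norm h_mul u)
      (h.tendsto_mul_smear_right h_norm mul_h u) c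
  refine mem_closure_of_tendsto ((h_lim a 0).prodMk_nhds (h_lim b z)) (Eventually.of_forall
    fun e => ⟨(_, _), (h.intertwines_of_mem_strictContGraph hab).1 _ _ ?_, rfl⟩)
  simpa using h.right.smear_mem_contGraph one_pos (e : A) 0 z

end StrictConvergence

/-! ### The strict core -/

theorem mem_domRestrict_graph {E : Type*} [AddCommGroup E] [Module ℂ E] {T : E →ₗ.[ℂ] E}
    {S : Submodule ℂ E} {x y : E} :
    (x, y) ∈ (T.domRestrict S).graph ↔ x ∈ S ∧ (x, y) ∈ T.graph := by
  simp only [LinearPMap.mem_graph_iff]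
  constructor
  · rintro ⟨⟨v, hv⟩, rfl, rfl⟩
    exact ⟨hv.1, ⟨v, hv.2⟩, rfl, rfl⟩
  · rintro ⟨hS, ⟨v, hv⟩, rfl, rfl⟩
    exact ⟨⟨v, hS, hv⟩, rfl, rfl⟩

variable {A : Type*} [NonUnitalCStarAlgebra A] {α αl αr β βl βr : ℝ → A →L[ℂ] A}

namespace IsSemiMultiplicativeWith

theorem incl_mem_strictContGraph_comp (hα : IsSemiMultiplicativeWith α αl αr)
    (hβ : IsSemiMultiplicativeWith β βl βr) (hcomm : ∀ s t x, α s (β t x) = β t (α s x)) {z : ℂ}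
    {p q : A} (hpq : (p, q) ∈ (pcomp (cont α z) (cont β z)).graph) :
    (incl A p, incl A q) ∈ strictContGraph (fun t => α t ∘L β t) z := by
  obtain ⟨w, hpw, hwq⟩ := mem_pcomp_graph.1 hpq
  rw [cont_graph] at hpw hwq
  exact (hα.comp hβ hcomm).incl_mem_strictContGraph (mem_contGraph_comp hα.rep hβ.rep hcomm hpw hwq)

/-- Strict continuations are strict limits of norm continuations, which in turn are norm limits of
pairs in the graphs of both products. -/
theorem strictContGraph_comp_subset_closure (hα : IsSemiMultiplicativeWith α αl αr)
    (hβ : IsSemiMultiplicativeWith β βl βr) (hcomm : ∀ s t x, α s (β t x) = β t (α s x)) (z : ℂ) :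
    (strictContGraph (fun t => α t ∘L β t) z : Set (𝓜(ℂ, A) × 𝓜(ℂ, A))) ⊆
      @closure _ (@instTopologicalSpaceProd _ _ (strictTopology A) (strictTopology A))
        (Prod.map (incl A) (incl A) ''
          ((pcomp (cont α z) (cont β z)).graph ⊓ (pcomp (cont β z) (cont α z)).graph :
            Submodule ℂ (A × A))) := by
  let _ := strictTopology A
  have h_incl : Continuous (Prod.map (incl A) (incl A)) :=
    continuous_strict_incl.prodMap continuous_strict_incl
  refine (hα.comp hβ hcomm).strictContGraph_subset_closure.trans
    (closure_minimal ?_ isClosed_closure)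
  exact (image_mono (contGraph_comp_subset_closure hα.rep hβ.rep hcomm)).trans
    (image_closure_subset_closure_image h_incl)

theorem isStrictCore (hα : IsSemiMultiplicativeWith α αl αr)
    (hβ : IsSemiMultiplicativeWith β βl βr) (hcomm : ∀ s t x, α s (β t x) = β t (α s x)) (z : ℂ) :
    IsStrictCore (strictCont (fun t => α t ∘L β t) z)
      (((pcomp (cont α z) (cont β z)).domain ⊓ (pcomp (cont β z) (cont α z)).domain).map
        (incl A)) := by
  refine ⟨?_, Subset.antisymm ?_ ?_⟩
  · rintro _ ⟨p, ⟨hp, -⟩, rfl⟩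
    have hpq := hα.incl_mem_strictContGraph_comp hβ hcomm (LinearPMap.mem_graph _ ⟨p, hp⟩)
    rw [← strictCont_graph] at hpq
    exact LinearPMap.mem_domain_of_mem_graph hpq
  · let _ := strictTopology A
    rw [strictCont_graph]
    refine closure_minimal (fun p hp => ?_) ((hα.comp hβ hcomm).isClosed_strictContGraph z)
    rw [← strictCont_graph]
    exact (mem_domRestrict_graph.1 hp).2
  · let _ := strictTopology A
    rw [strictCont_graph]
    refine (hα.strictContGraph_comp_subset_closure hβ hcomm z).trans (closure_mono ?_)
    rintro _ ⟨⟨p, q⟩, ⟨h_left, h_right⟩, rfl⟩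
    refine mem_domRestrict_graph.2 ⟨Submodule.mem_map_of_mem
      ⟨LinearPMap.mem_domain_of_mem_graph h_left, LinearPMap.mem_domain_of_mem_graph h_right⟩, ?_⟩
    rw [strictCont_graph]
    exact hα.incl_mem_strictContGraph_comp hβ hcomm h_left

end IsSemiMultiplicativeWith

end OneParam

end

theorem mainTheorem6 {A : Type*} [NonUnitalCStarAlgebra A] (α β γ : ℝ → A →L[ℂ] A)
    (hα : OneParam.IsRep α) (hβ : OneParam.IsRep β)
    (hαm : OneParam.IsSemiMultiplicative α) (hβm : OneParam.IsSemiMultiplicative β)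
    (hcomm : ∀ s t : ℝ, α s ∘L β t = β t ∘L α s)
    (hγ : ∀ t : ℝ, γ t = α t ∘L β t) (z : ℂ) :
    OneParam.pcomp (OneParam.strictCont α z) (OneParam.strictCont β z)
        ≤ OneParam.strictCont γ z ∧
      OneParam.pcomp (OneParam.strictCont β z) (OneParam.strictCont α z)
        ≤ OneParam.strictCont γ z ∧
      OneParam.IsStrictCore (OneParam.strictCont γ z)
        (((OneParam.pcomp (OneParam.cont α z) (OneParam.cont β z)).domain ⊓
          (OneParam.pcomp (OneParam.cont β z) (OneParam.cont α z)).domain).map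
            (OneParam.incl A)) := by
  obtain ⟨αl, αr, hα'⟩ := hαm.exists_with hα
  obtain ⟨βl, βr, hβ'⟩ := hβm.exists_with hβ
  have hc : ∀ s t x, α s (β t x) = β t (α s x) := fun s t x => DFunLike.congr_fun (hcomm s t) x
  obtain rfl : γ = fun t => α t ∘L β t := funext hγ
  refine ⟨hα'.pcomp_strictCont_le hβ' hc z, ?_, hα'.isStrictCore hβ' hc z⟩
  have := hβ'.pcomp_strictCont_le hα' (fun s t x => (hc t s x).symm) z
  simpa only [hcomm] using this
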